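/- Write $\log$ for the logarithm to base $2$. For $S\subseteq\{0,\dots,n\}$ non-empty let $U_S^n$ be the uniform distribution over the strings in $\{0,1\}^n$ whose Hamming weight lies in $S$, and let $U_k^n=U_{\{k\}}^n$. A distribution $P$ on $\{0,1\}^n$ can be sampled with decision depth $d$ and error $\eta$ if there are $m\in\mathbb N$ and $f:\{0,1\}^m\to\{0,1\}^n$, each of whose output bits is computed by a decision tree making at most $d$ adaptive queries to the input bits, such that the distribution $X$ of $f$ on a uniformly random input has statistical distance $\eta=\frac12\sum_{x\in\{0,1\}^n}|X(x)-P(x)|$ from $P$. (1) For every $\epsilon>0$ there are a constant $\tau>0$ and an $n_0$ such that for all $n\ge n_0$ and all integers $1\le k\le n/4$: if $U_k^n$ can be sampled with decision depth $d\le\tau\,\dfrac{\log(n/k)}{\log\log(n/k)}$ and error $\eta$, then $\eta\ge 1-\epsilon$. (2) There are constants $\tau,c>0$ such that for every $\epsilon\in(0,1)$ there is an $n_0$ such that the following holds for all $n\ge n_0$ and all integers $1\le k\le n$. Suppose that $U_k^n$ can be sampled with decision depth $d$ and error $\eta$, where either $\log n\le k\le 2^{(\log n)^{1-\epsilon}}$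 and $d\le\tau(\log n)^{\epsilon}$, or $1\le k<\log n$ and $d\le\tau(\log n)^{\epsilon}/\log\log n$. Then $\eta\ge 1-n^{-ck}$ (that is, $\eta=1-n^{-\Omega(k)}$). Moreover, for every $\epsilon>0$ there are $\tau>0$ and $n_0$ such that for all $n\ge n_0$, all integers $1\le k\le n/4$ and all non-empty $S\subseteq\{0,\dots,n\}$ with $\max S=k$ or $\min S=n-k$: if $U_S^n$ can be sampled with decision depth $d\le\tau\,\dfrac{\log(n/k)}{\log\log(n/k)}$ and error $\eta$, then $\eta\ge 1-\epsilon$. -/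

import Mathlib

/-- A Boolean decision tree whose inner nodes query one of `m` input bits. -/
inductive DecisionTree (m : ℕ) : Type where
  | leaf (b : Bool) : DecisionTree m
  | query (i : Fin m) (t₀ t₁ : DecisionTree m) : DecisionTree m

namespace DecisionTree

/-- The maximal number of queries on a root-to-leaf path. -/
def depth {m : ℕ} : DecisionTree m → ℕ
  | leaf _ => 0
  | query _ t₀ t₁ => max t₀.depth t₁.depth + 1

/-- The output of the tree on input `x`: a query node continues in `t₁` if the queried bit
is `1` and in `t₀` if it is `0`. -/
def eval {m : ℕ} : DecisionTree m → (Fin m → Bool) → Bool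
  | leaf b, _ => b
  | query i t₀ t₁, x => if x i = true then t₁.eval x else t₀.eval x

end DecisionTree

/-- `f : {0,1}^m → {0,1}^n` is computed by a decision forest of depth (at most) `d`: every
output bit is computed by a decision tree making at most `d` adaptive queries. -/
def HasDecisionDepth {m n : ℕ} (f : (Fin m → Bool) → (Fin n → Bool)) (d : ℕ) : Prop :=
  ∀ j : Fin n, ∃ T : DecisionTree m, T.depth ≤ d ∧ ∀ x, T.eval x = f x j

/-- The Hamming weight of a bit string. -/
def weight {n : ℕ} (x : Fin n → Bool) : ℕ :=
  (Finset.univ.filter fun i => x i = true).card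

/-- The statistical (total variation) distance of two distributions on a finite set. -/
noncomputable def statDist {α : Type} [Fintype α] (P Q : PMF α) : ℝ :=
  (1 / 2) * ∑ a, |(P a).toReal - (Q a).toReal|

open Classical in
/-- The set of `n`-bit strings whose Hamming weight lies in `S`. -/
noncomputable def stringsOfWeight (n : ℕ) (S : Set ℕ) : Finset (Fin n → Bool) :=
  Finset.univ.filter fun x => weight x ∈ S

theorem stringsOfWeight_nonempty (n : ℕ) (S : Set ℕ) (hS : ∃ k ∈ S, k ≤ n) :
    (stringsOfWeight n S).Nonempty := by
  obtain ⟨k, hk, hkn⟩ := hS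
  obtain ⟨A, -, hA⟩ := Finset.exists_subset_card_eq
    (s := (Finset.univ : Finset (Fin n))) (n := k) (by simpa using hkn)
  refine ⟨fun i => decide (i ∈ A), ?_⟩
  have hw : weight (fun i => decide (i ∈ A)) = k := by simp [weight, hA]
  simp only [stringsOfWeight, Finset.mem_filter, Finset.mem_univ, true_and]
  rw [hw]
  exact hk

/-- The uniform distribution over the `n`-bit strings whose Hamming weight lies in `S`. -/
noncomputable def uniformUnion (n : ℕ) (S : Set ℕ) (hS : ∃ k ∈ S, k ≤ n) :
    PMF (Fin n → Bool) :=
  PMF.uniformOfFinset (stringsOfWeight n S) (stringsOfWeight_nonempty n S hS)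

/-- The uniform distribution over the `n`-bit strings of Hamming weight `k`. -/
noncomputable def uniformSlice (n k : ℕ) (hk : k ≤ n) : PMF (Fin n → Bool) :=
  uniformUnion n {k} ⟨k, rfl, hk⟩

/-- The distribution of `f` on a uniformly random input. -/
noncomputable def outputDist {m n : ℕ} (f : (Fin m → Bool) → (Fin n → Bool)) :
    PMF (Fin n → Bool) :=
  (PMF.uniformOfFintype (Fin m → Bool)).map f

/-- `P` can be sampled with decision depth `d` and error `η`: some decision forest of depth
`d`, run on some number of independent uniform input bits, has an output distribution at
statistical distance `η` from `P`. -/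
def CanSample {n : ℕ} (P : PMF (Fin n → Bool)) (d : ℕ) (η : ℝ) : Prop :=
  ∃ (m : ℕ) (f : (Fin m → Bool) → (Fin n → Bool)),
    HasDecisionDepth f d ∧ statDist (outputDist f) P = η

/-!
A decision forest of low depth cannot have an output whose weight is both small and spread over
most coordinates, because its accepting paths form a set system to which a robust sunflower
argument applies.

Let `f` be computed by a forest of depth `D`. Every output bit equal to `1` is certified by an
accepting path, a term of at most `D` literals on the input bits. Call a set of literals a kernel
(`IsKernel`) if some distribution on the terms containing it is spread outside the kernel and gives
no term too much mass. Conditioned on a kernel being satisfied, a Janson-type lower tail bound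
(`janson_lower_tail`, `spread_lower_tail`) shows that more than `k` outputs equal `1` except with
probability `exp (-H)`, where the spreadness needed is only of order `D * H`
(`IsKernel.card_few_satisfied_le`).

Two facts about kernels make a union bound possible. On the one hand, any family of sufficiently
many terms contains a kernel (`exists_isKernel_of_card`), so that the outputs having an accepting
path without a kernel form a small set `J`. On the other hand, there are few minimal kernels
(`card_le_of_minimal_gradedKernel`): many kernels of the same size contain a spread subfamily over
a smaller set, and averaging their distributions makes that smaller set a kernel
(`IsKernel.merge`). Averaging loses a factor `1 + 1 / D` in the spreadness, at most `D` times,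
which is why kernels are graded by size. The bound on their number does not depend on the number
`n` of outputs, so that the argument still works when `k` grows linearly with `n`.

Hence the output of `f`, when of weight at most `k`, is supported in `J` except with probability at
most the number of kernels times `exp (-H)` (`exists_small_support`), while a random string from
the slices is hardly ever supported in `J`. Taking `H = log (n / k)` gives the bounds `1 - ε`, and
`H = k * log n` the bound `1 - n ^ (-c k)` for subpolynomial weights. Slices of weight at least
`n - k` reduce to those of weight at most `k` by flipping all output bits.
-/

namespace SliceSampling
open Finset

/-! ### Spread kernels -/

/-- `K` is a kernel of the set system `A` if some probability distribution `q` on the members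
containing `K`, giving no member more than `1 / L`, is `1 / ρ`-spread outside `K`: a set `T`
disjoint from `K` is contained in a random member with probability at most `ρ ^ |T|`. -/
def IsKernel {α V : Type*} [Fintype α] [DecidableEq V] (A : α → Finset V) (L ρ : ℝ)
    (K : Finset V) : Prop :=
  ∃ q : α → ℝ, (∀ x, 0 ≤ q x) ∧ ∑ x, q x = 1 ∧ (∀ x, L * q x ≤ 1) ∧
    (∀ x, q x ≠ 0 → K ⊆ A x) ∧
    ∀ T, Disjoint T K → ∑ x with T ⊆ A x, q x ≤ ρ ^ #T

/-- A kernel whose spreadness requirement is relaxed by a factor `1 + 1 / D` for each element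
that the kernel has fewer than `D`. The slack pays for merging kernels into smaller ones. -/
def IsGradedKernel {α V : Type*} [Fintype α] [DecidableEq V] (A : α → Finset V) (L ρ : ℝ)
    (D : ℕ) (K : Finset V) : Prop :=
  IsKernel A L (ρ * (1 + 1 / D) ^ (D - #K)) K

section

variable {α β V : Type*} [DecidableEq V]

theorem IsKernel.mono [Fintype α] {A : α → Finset V} {L ρ ρ' : ℝ} {K : Finset V} (hρ : 0 ≤ ρ)
    (h : IsKernel A L ρ K) (hle : ρ ≤ ρ') : IsKernel A L ρ' K := by
  obtain ⟨q, h0, h1, h2, h3, h4⟩ := h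
  exact ⟨q, h0, h1, h2, h3, fun T hT => (h4 T hT).trans (pow_le_pow_left₀ hρ hle _)⟩

theorem IsKernel.exists_subset [Fintype α] {A : α → Finset V} {L ρ : ℝ} {K : Finset V}
    (h : IsKernel A L ρ K) : ∃ x, K ⊆ A x := by
  obtain ⟨q, h0, h1, h2, h3, h4⟩ := h
  by_contra! hne
  have : ∀ x, q x = 0 := fun x => by
    by_contra hx
    exact hne x (h3 x hx)
  simp [this] at h1

/-- A set maximising the number of members containing it, weighted by `r ^ |K|`, has an
`r`-spread link. -/
theorem exists_spread_link [Fintype V] (s : Finset β) (F : β → Finset V) {r : ℝ} (hr : 0 < r) :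
    ∃ K : Finset V, (#s : ℝ) ≤ #{x ∈ s | K ⊆ F x} * r ^ #K ∧
      ∀ T, Disjoint T K →
        (#{x ∈ s | K ⊆ F x ∧ T ⊆ F x} : ℝ) * r ^ #T ≤ #{x ∈ s | K ⊆ F x} := by
  obtain ⟨K, hK⟩ := Finite.exists_max
    (fun K : Finset V => (#{x ∈ s | K ⊆ F x} : ℝ) * r ^ #K)
  refine ⟨K, by simpa using hK ∅, fun T hT => ?_⟩
  have h := hK (K ∪ T)
  rw [card_union_of_disjoint hT.symm, pow_add] at h
  simp only [union_subset_iff] at h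
  have hp : 0 < r ^ #K := by positivity
  refine le_of_mul_le_mul_right ?_ hp
  linarith

/-- Many members of size at most `D` force a kernel, contained in one of them. -/
theorem exists_isKernel_of_card [Fintype V] [Fintype α] (A : α → Finset V) (s : Finset α)
    {D : ℕ} (hA : ∀ x, #(A x) ≤ D) {L r : ℝ} (hL : 0 < L) (hr : 1 ≤ r)
    (hs : L * r ^ D < #s) : ∃ K, IsKernel A L (1 / r) K ∧ ∃ x ∈ s, K ⊆ A x := by
  classical
  have hr0 : 0 < r := by linarith
  obtain ⟨K, hK, hT⟩ := exists_spread_link s A hr0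
  set c : ℝ := (#{x ∈ s | K ⊆ A x} : ℝ) with hc
  have hpos : 0 < c * r ^ #K := lt_of_lt_of_le (lt_of_le_of_lt (by positivity) hs) hK
  have hc0 : 0 < c := pos_of_mul_pos_left hpos (by positivity)
  obtain ⟨x, hx⟩ : ({x ∈ s | K ⊆ A x}).Nonempty := by
    rw [← card_pos]
    exact_mod_cast hc.symm ▸ hc0
  rw [mem_filter] at hx
  have hKD : #K ≤ D := (card_le_card hx.2).trans (hA x)
  have hcL : L ≤ c := by
    have h1 : r ^ #K ≤ r ^ D := pow_le_pow_right₀ hr hKD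
    have h2 : L * r ^ D < c * r ^ D :=
      hs.trans_le (hK.trans (mul_le_mul_of_nonneg_left h1 hc0.le))
    exact (lt_of_mul_lt_mul_right h2 (by positivity)).le
  refine ⟨K, ⟨fun x => if x ∈ s ∧ K ⊆ A x then 1 / c else 0, ?_, ?_, ?_, ?_, ?_⟩, x, hx⟩
  · intro x; dsimp only; split_ifs <;> positivity
  · rw [← sum_filter, sum_const, nsmul_eq_mul]
    have : (univ.filter fun x => x ∈ s ∧ K ⊆ A x) = {x ∈ s | K ⊆ A x} := by ext; simp
    rw [this, ← hc]; field_simp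
  · intro x; dsimp only
    split_ifs
    · rw [mul_one_div, div_le_one hc0]; exact hcL
    · simp
  · intro x hx; by_contra h; simp [h] at hx
  · intro T hTK
    rw [← sum_filter, sum_const, nsmul_eq_mul, filter_filter]
    have : (univ.filter fun x => T ⊆ A x ∧ x ∈ s ∧ K ⊆ A x) = {x ∈ s | K ⊆ A x ∧ T ⊆ A x} := by
      ext; simp; tauto
    rw [this, mul_one_div, one_div_pow, div_le_div_iff₀ hc0 (by positivity), one_mul]
    exact hT T hTK

/-- Averaging the distributions of kernels `K ∈ S` that contain `K₀` and are themselves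
`R`-spread over `K₀` makes `K₀` a kernel: a set disjoint from `K₀` splits into its part inside
the random `K` and its part outside. -/
theorem IsKernel.merge [Fintype α] {A : α → Finset V} {L ρ R : ℝ} (hρ : 0 ≤ ρ) (hR : 0 < R)
    (S : Finset (Finset V)) (hS : S.Nonempty) (hker : ∀ K ∈ S, IsKernel A L ρ K)
    (K₀ : Finset V) (hsub : ∀ K ∈ S, K₀ ⊆ K)
    (hspread : ∀ T, Disjoint T K₀ → (#{K ∈ S | T ⊆ K} : ℝ) * R ^ #T ≤ #S) :
    IsKernel A L (ρ + 1 / R) K₀ := by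
  classical
  choose! q h0 h1 h2 h3 h4 using hker
  have hc : (0 : ℝ) < #S := by exact_mod_cast hS.card_pos
  refine ⟨fun x => (∑ K ∈ S, q K x) / #S, ?_, ?_, ?_, ?_, ?_⟩
  · intro x
    exact div_nonneg (sum_nonneg fun K hK => h0 K hK x) hc.le
  · rw [← sum_div, sum_comm, sum_congr rfl h1]
    simp [hc.ne']
  · intro x
    rw [← mul_div_assoc, div_le_one hc, mul_sum]
    calc ∑ K ∈ S, L * q K x ≤ ∑ K ∈ S, 1 := sum_le_sum fun K hK => h2 K hK x
      _ = #S := by simp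
  · intro x hx
    obtain ⟨K, hK, hne⟩ : ∃ K ∈ S, q K x ≠ 0 := by
      by_contra! h
      exact hx (by simp only [sum_eq_zero h, zero_div])
    exact (hsub K hK).trans (h3 K hK x hne)
  · intro T hT
    rw [← sum_div, sum_comm, div_le_iff₀ hc]
    have key : ∀ K ∈ S, ∑ x with T ⊆ A x, q K x ≤
        ∑ U ∈ T.powerset, if U ⊆ K then ρ ^ (#T - #U) else 0 := by
      intro K hK
      have hTU : T ∩ K ∈ T.powerset := by simp
      refine le_trans ?_ (single_le_sum (f := fun U => if U ⊆ K then ρ ^ (#T - #U) else 0)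
        (fun U _ => by split_ifs <;> positivity) hTU)
      rw [if_pos inter_subset_right]
      have hcard : #T - #(T ∩ K) = #(T \ K) := by
        have := card_sdiff_add_card_inter T K
        omega
      rw [hcard]
      refine le_trans (sum_le_sum_of_subset_of_nonneg ?_ fun x _ _ => h0 K hK x)
        (h4 K hK (T \ K) disjoint_sdiff_self_left)
      intro x hx
      simp only [mem_filter, mem_univ, true_and] at hx ⊢
      exact sdiff_subset.trans hx
    calc ∑ K ∈ S, ∑ x with T ⊆ A x, q K x
        ≤ ∑ K ∈ S, ∑ U ∈ T.powerset, if U ⊆ K then ρ ^ (#T - #U) else 0 := sum_le_sum key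
      _ = ∑ U ∈ T.powerset, #{K ∈ S | U ⊆ K} * ρ ^ (#T - #U) := by
          rw [sum_comm]
          refine sum_congr rfl fun U _ => ?_
          rw [← sum_filter, sum_const, nsmul_eq_mul]
      _ ≤ ∑ U ∈ T.powerset, #S * ((1 / R) ^ #U * ρ ^ (#T - #U)) := by
          refine sum_le_sum fun U hU => ?_
          rw [← mul_assoc]
          refine mul_le_mul_of_nonneg_right ?_ (by positivity)
          rw [one_div_pow, mul_one_div, le_div_iff₀ (by positivity)]
          exact hspread U (disjoint_of_subset_left (mem_powerset.mp hU) hT)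
      _ = (ρ + 1 / R) ^ #T * #S := by
          rw [← mul_sum, sum_pow_mul_eq_add_pow, add_comm, mul_comm]

/-- There are few minimal graded kernels of each size: too many of them would merge into a
strictly smaller one. -/
theorem card_le_of_minimal_gradedKernel [Fintype V] [Fintype α] {A : α → Finset V} {L ρ : ℝ}
    {D w : ℕ} (hρ : 0 < ρ) (hD : 0 < D) (hw : w ≤ D) (S : Finset (Finset V))
    (hS : ∀ K ∈ S, Minimal (IsGradedKernel A L ρ D) K ∧ #K = w) :
    (#S : ℝ) ≤ (D / ρ) ^ w := by
  classical
  by_contra! hlt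
  have hD' : (0 : ℝ) < D := by exact_mod_cast hD
  have hR : 0 < (D : ℝ) / ρ := by positivity
  obtain ⟨K₀, h1, h2⟩ := exists_spread_link S id hR
  simp only [id] at h1 h2
  set S' := {K ∈ S | K₀ ⊆ K} with hS'
  have hne : S'.Nonempty := by
    rw [nonempty_iff_ne_empty]
    intro h
    rw [h] at h1
    simp only [card_empty, Nat.cast_zero, zero_mul] at h1
    exact absurd (hlt.trans_le h1) (not_lt.mpr (by positivity))
  obtain ⟨K, hK⟩ := hne
  have hKS := mem_filter.mp hK
  have hss : K₀ ⊂ K := by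
    refine hKS.2.ssubset_of_ne fun heq => ?_
    have hone : #S' ≤ 1 := by
      refine card_le_one.mpr fun X hX Y hY => ?_
      have hX' := mem_filter.mp hX
      have hY' := mem_filter.mp hY
      have e : ∀ Z ∈ S, K₀ ⊆ Z → Z = K₀ := fun Z hZ hsub =>
        (eq_of_subset_of_card_le hsub (by rw [heq, (hS Z hZ).2, (hS K hKS.1).2])).symm
      rw [e X hX'.1 hX'.2, e Y hY'.1 hY'.2]
    rw [heq, (hS K hKS.1).2] at h1
    have : (#S' : ℝ) ≤ 1 := by exact_mod_cast hone
    have h3 := mul_le_mul_of_nonneg_right this (pow_nonneg hR.le w)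
    linarith
  have hlt' : #K₀ < w := by rw [← (hS K hKS.1).2]; exact card_lt_card hss
  have hgk : IsGradedKernel A L ρ D K₀ := by
    set ρw := ρ * (1 + 1 / (D : ℝ)) ^ (D - w) with hρw
    have hge : ρ ≤ ρw := by
      rw [hρw]
      refine le_mul_of_one_le_right hρ.le (one_le_pow₀ ?_)
      have : 0 < 1 / (D : ℝ) := by positivity
      linarith
    have hm : IsKernel A L (ρw + 1 / (D / ρ)) K₀ := by
      refine IsKernel.merge (hρ.le.trans hge) hR S' ⟨K, hK⟩ ?_ K₀
        (fun X hX => (mem_filter.mp hX).2) ?_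
      · intro X hX
        have := (hS X (mem_filter.mp hX).1)
        have h := this.1.prop
        rwa [IsGradedKernel, this.2] at h
      · intro T hT
        rw [hS', filter_filter]
        exact h2 T hT
    refine hm.mono (by positivity) ?_
    have hexp : D - #K₀ = (D - w) + (w - #K₀ - 1) + 1 := by omega
    calc ρw + 1 / (D / ρ) ≤ ρw * (1 + 1 / D) := by
          rw [one_div_div, mul_add, mul_one, mul_one_div]
          gcongr
      _ ≤ ρ * (1 + 1 / (D : ℝ)) ^ (D - #K₀) := by
          rw [hρw, mul_assoc, ← pow_succ]
          refine mul_le_mul_of_nonneg_left (pow_le_pow_right₀ ?_ (by omega)) hρ.le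
          have : 0 < 1 / (D : ℝ) := by positivity
          linarith
  exact hss.2 ((hS K hKS.1).1.2 hgk hss.1)

theorem IsGradedKernel.isKernel_three [Fintype α] {A : α → Finset V} {L ρ : ℝ} {D : ℕ}
    {K : Finset V} (hρ : 0 ≤ ρ) (hD : 0 < D) (h : IsGradedKernel A L ρ D K) :
    IsKernel A L (3 * ρ) K := by
  have hD' : (0 : ℝ) < D := by exact_mod_cast hD
  refine IsKernel.mono (by positivity) h ?_
  have h1 : (1 + 1 / (D : ℝ)) ^ (D - #K) ≤ 3 := by
    calc (1 + 1 / (D : ℝ)) ^ (D - #K) ≤ (1 + 1 / (D : ℝ)) ^ D := by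
          refine pow_le_pow_right₀ ?_ (Nat.sub_le _ _)
          have : 0 < 1 / (D : ℝ) := by positivity
          linarith
      _ ≤ Real.exp (1 / D) ^ D := by
          refine pow_le_pow_left₀ (by positivity) ?_ _
          rw [add_comm]
          exact Real.add_one_le_exp _
      _ = Real.exp 1 := by
          rw [← Real.exp_nat_mul]
          congr 1
          field_simp
      _ ≤ 3 := Real.exp_one_lt_d9.le.trans (by norm_num)
  nlinarith

end

/-! ### Janson's lower tail inequality -/

section

variable {ι α : Type*} [Fintype ι] [DecidableEq ι] [Fintype α]

/-- Adding `U` to a uniformly random set gives a uniformly random superset of `U`. This serves as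
an elementary substitute for Harris' correlation inequality below. -/
theorem sum_union_eq (U : Finset ι) (g : Finset ι → ℝ) :
    ∑ s, g (s ∪ U) = 2 ^ #U * ∑ s with U ⊆ s, g s := by
  rw [← sum_fiberwise_of_maps_to (s := univ) (t := univ.filter fun s => U ⊆ s)
    (g := fun s => s ∪ U) (fun s _ => by simp), mul_sum]
  refine sum_congr rfl fun t ht => ?_
  rw [mem_filter] at ht
  rw [sum_congr rfl (g := fun _ => g t) (fun s hs => by rw [(mem_filter.mp hs).2]), sum_const,
    nsmul_eq_mul]
  congr 1
  have : (univ.filter fun s => s ∪ U = t) = Icc (t \ U) t := by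
    ext s
    simp only [mem_filter, mem_univ, true_and, mem_Icc]
    constructor
    · rintro rfl
      refine ⟨?_, subset_union_left⟩
      rw [union_sdiff_right]
      exact sdiff_subset
    · rintro ⟨h1, h2⟩
      refine subset_antisymm (union_subset h2 ht.2) fun i hi => ?_
      by_cases hiU : i ∈ U
      · simp [hiU]
      · exact mem_union_left _ (h1 (by simp [hi, hiU]))
  rw [this, card_Icc_finset sdiff_subset, card_sdiff_of_subset ht.2,
    Nat.sub_sub_self (card_le_card ht.2)]
  push_cast
  rfl

/-- **Janson's lower tail inequality** for a nonnegative combination `Y` of the events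
`C a ⊆ s`, where `s` is a uniformly random set, `μ` is the mean of `Y` and `Δ` bounds the
contribution of intersecting pairs to its second moment. -/
theorem janson_lower_tail (C : α → Finset ι) (v : α → ℝ) (hv : ∀ a, 0 ≤ v a) {μ Δ : ℝ}
    (hμ0 : 0 ≤ μ) (hμ : μ = ∑ a, v a / 2 ^ #(C a)) (hΔ0 : 0 < Δ)
    (hΔ : ∑ a, ∑ b, (if Disjoint (C a) (C b) then 0 else v a * v b / 2 ^ #(C a ∪ C b)) ≤ Δ) :
    (#{s : Finset ι | ∑ a with C a ⊆ s, v a ≤ μ / 2} : ℝ) ≤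
      2 ^ Fintype.card ι * Real.exp (-(μ ^ 2 / (8 * Δ))) := by
  set Y : Finset ι → ℝ := fun s => ∑ a with C a ⊆ s, v a with hY
  set Ψ : ℝ → ℝ := fun l => ∑ s, Real.exp (-l * Y s) with hΨ
  have hΨpos : ∀ l, 0 ≤ Ψ l := fun l => sum_nonneg fun s _ => (Real.exp_pos _).le
  -- The contribution of one event to the logarithmic derivative of `Ψ`.
  have hterm : ∀ l, 0 ≤ l → ∀ a, (1 / 2 ^ #(C a) -
      l * ∑ b, (if Disjoint (C a) (C b) then 0 else v b / 2 ^ #(C a ∪ C b))) * Ψ l ≤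
        ∑ s with C a ⊆ s, Real.exp (-l * Y s) := by
    intro l hl a
    -- `Z` collects the events disjoint from `C a`, and `W` the others.
    set Z : Finset ι → ℝ := fun s => ∑ b with C b ⊆ s ∧ Disjoint (C a) (C b), v b with hZ
    set W : Finset ι → ℝ := fun s => ∑ b with C b ⊆ s ∧ ¬ Disjoint (C a) (C b), v b with hW
    set g : Finset ι → ℝ := fun s => Real.exp (-l * Z s) with hg
    have hYZW : ∀ s, Y s = Z s + W s := by
      intro s
      simp only [hY, hZ, hW, ← filter_filter]
      exact (sum_filter_add_sum_filter_not _ _ _).symm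
    have hZU : ∀ s, Z (s ∪ C a) = Z s := by
      intro s
      simp only [hZ]
      refine sum_congr (filter_congr fun b _ => and_congr_left fun hd => ?_) fun _ _ => rfl
      exact ⟨fun h i hi => (mem_union.mp (h hi)).resolve_right
        (Finset.disjoint_right.mp hd hi), fun h => h.trans subset_union_left⟩
    have hZmono : ∀ s t, s ⊆ t → Z s ≤ Z t := by
      intro s t hst
      simp only [hZ]
      refine sum_le_sum_of_subset_of_nonneg (fun b hb => ?_) fun b _ _ => hv b
      simp only [mem_filter, mem_univ, true_and] at hb ⊢
      exact ⟨hb.1.trans hst, hb.2⟩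
    have hgpos : ∀ s, 0 ≤ g s := fun s => (Real.exp_pos _).le
    have hindep : ∑ s with C a ⊆ s, g s = 1 / 2 ^ #(C a) * ∑ s, g s := by
      have h := sum_union_eq (C a) g
      rw [sum_congr rfl (fun s _ => show g (s ∪ C a) = g s by simp only [hg, hZU])] at h
      rw [h]
      field_simp
    have hharris : ∀ U : Finset ι, ∑ s with U ⊆ s, g s ≤ 1 / 2 ^ #U * ∑ s, g s := by
      intro U
      have h := sum_union_eq U g
      have h' : ∑ s, g (s ∪ U) ≤ ∑ s, g s := sum_le_sum fun s _ => by
        simp only [hg]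
        have := hZmono s (s ∪ U) subset_union_left
        refine Real.exp_le_exp.mpr ?_
        nlinarith
      rw [one_div_mul_eq_div, le_div_iff₀ (by positivity)]
      linarith
    have hlow : ∑ s with C a ⊆ s, (g s - l * (W s * g s)) ≤
        ∑ s with C a ⊆ s, Real.exp (-l * Y s) := by
      refine sum_le_sum fun s _ => ?_
      have : Real.exp (-l * Y s) = Real.exp (-l * W s) * g s := by
        rw [hYZW, hg, ← Real.exp_add]
        ring_nf
      rw [this]
      have h1 := Real.add_one_le_exp (-l * W s)
      nlinarith [hgpos s]
    have hWg : ∑ s with C a ⊆ s, W s * g s ≤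
        (∑ b, (if Disjoint (C a) (C b) then 0 else v b / 2 ^ #(C a ∪ C b))) * ∑ s, g s := by
      have : ∀ s, W s * g s = ∑ b, if ¬ Disjoint (C a) (C b) then
          (if C b ⊆ s then v b * g s else 0) else 0 := by
        intro s
        simp only [hW]
        rw [sum_mul, sum_filter]
        refine sum_congr rfl fun b _ => ?_
        by_cases h1 : C b ⊆ s <;> by_cases h2 : Disjoint (C a) (C b) <;> simp [h1, h2]
      rw [sum_congr rfl fun s _ => this s, sum_comm, sum_mul]
      refine sum_le_sum fun b _ => ?_
      by_cases hd : Disjoint (C a) (C b)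
      · simp [hd]
      · simp only [hd, not_false_eq_true, if_true, if_false]
        rw [← sum_filter, filter_filter]
        have e : (univ.filter fun s => C a ⊆ s ∧ C b ⊆ s) =
            univ.filter fun s => C a ∪ C b ⊆ s := by
          ext s; simp [union_subset_iff]
        rw [e, ← mul_sum]
        have := mul_le_mul_of_nonneg_left (hharris (C a ∪ C b)) (hv b)
        calc _ ≤ _ := this
          _ = _ := by ring
    have hgΨ : Ψ l ≤ ∑ s, g s := sum_le_sum fun s _ => by
      simp only [hg]
      refine Real.exp_le_exp.mpr ?_
      have hWnn : 0 ≤ W s := sum_nonneg fun b _ => hv b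
      have := hYZW s
      nlinarith
    set c := 1 / 2 ^ #(C a) -
      l * ∑ b, (if Disjoint (C a) (C b) then 0 else v b / 2 ^ #(C a ∪ C b)) with hc
    rcases le_total c 0 with hneg | hpos
    · exact (mul_nonpos_of_nonpos_of_nonneg hneg (hΨpos l)).trans
        (sum_nonneg fun s _ => (Real.exp_pos _).le)
    · refine (mul_le_mul_of_nonneg_left hgΨ hpos).trans (le_trans ?_ hlow)
      rw [sum_sub_distrib, ← mul_sum, hindep, hc, sub_mul, mul_assoc]
      have := mul_le_mul_of_nonneg_left hWg hl
      linarith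
  have hderiv : ∀ l, 0 ≤ l → (μ - l * Δ) * Ψ l ≤ ∑ s, Y s * Real.exp (-l * Y s) := by
    intro l hl
    have e : ∑ s, Y s * Real.exp (-l * Y s) =
        ∑ a, v a * ∑ s with C a ⊆ s, Real.exp (-l * Y s) := by
      simp only [mul_sum]
      simp only [sum_filter]
      rw [sum_comm]
      refine sum_congr rfl fun s _ => ?_
      rw [← sum_filter, ← sum_mul]
    rw [e]
    calc (μ - l * Δ) * Ψ l ≤ (∑ a, v a * (1 / 2 ^ #(C a) -
          l * ∑ b, (if Disjoint (C a) (C b) then 0 else v b / 2 ^ #(C a ∪ C b)))) * Ψ l := by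
          refine mul_le_mul_of_nonneg_right ?_ (hΨpos l)
          have : ∑ a, v a * (1 / 2 ^ #(C a) -
              l * ∑ b, (if Disjoint (C a) (C b) then 0 else v b / 2 ^ #(C a ∪ C b))) =
              μ - l * ∑ a, ∑ b,
                (if Disjoint (C a) (C b) then 0 else v a * v b / 2 ^ #(C a ∪ C b)) := by
            rw [hμ, mul_sum, ← sum_sub_distrib]
            refine sum_congr rfl fun a _ => ?_
            rw [mul_sub, mul_one_div, mul_left_comm, mul_sum]
            congr 2
            refine sum_congr rfl fun b _ => ?_
            split_ifs <;> ring
          rw [this]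
          have := mul_le_mul_of_nonneg_left hΔ hl
          linarith
      _ = ∑ a, v a * ((1 / 2 ^ #(C a) -
          l * ∑ b, (if Disjoint (C a) (C b) then 0 else v b / 2 ^ #(C a ∪ C b))) * Ψ l) := by
          rw [sum_mul]
          exact sum_congr rfl fun a _ => mul_assoc _ _ _
      _ ≤ _ := sum_le_sum fun a _ => mul_le_mul_of_nonneg_left (hterm l hl a) (hv a)
  -- Integrating the differential inequality `Ψ' ≤ -(μ - l Δ) Ψ`.
  have hΨbound : ∀ l, 0 ≤ l →
      Ψ l ≤ 2 ^ Fintype.card ι * Real.exp (-(l * μ - l ^ 2 * Δ / 2)) := by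
    set G : ℝ → ℝ := fun l => Ψ l * Real.exp (l * μ - l ^ 2 * Δ / 2) with hG
    have hd : ∀ l, HasDerivAt G
        ((∑ s, -(Y s * Real.exp (-l * Y s))) * Real.exp (l * μ - l ^ 2 * Δ / 2) +
          Ψ l * (Real.exp (l * μ - l ^ 2 * Δ / 2) * (μ - l * Δ))) l := by
      intro l
      refine HasDerivAt.mul ?_ ?_
      · refine HasDerivAt.fun_sum fun s _ => ?_
        exact (((hasDerivAt_neg' l).mul_const (Y s)).exp).congr_deriv (by ring)
      · have h1 : HasDerivAt (fun l : ℝ => l * μ - l ^ 2 * Δ / 2) (μ - l * Δ) l := by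
          exact (((hasDerivAt_id' l).mul_const μ).sub
            (((hasDerivAt_pow 2 l).mul_const Δ).div_const 2)).congr_deriv (by push_cast; ring)
        exact h1.exp
    have hanti : AntitoneOn G (Set.Ici 0) := by
      refine antitoneOn_of_deriv_nonpos (convex_Ici 0)
        (fun l _ => (hd l).continuousAt.continuousWithinAt)
        (fun l _ => (hd l).differentiableAt.differentiableWithinAt) ?_
      intro l hl
      rw [interior_Ici, Set.mem_Ioi] at hl
      rw [(hd l).deriv, sum_neg_distrib]
      have h1 := hderiv l hl.le
      have h2 := (Real.exp_pos (l * μ - l ^ 2 * Δ / 2)).le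
      nlinarith
    intro l hl
    have h := hanti (Set.mem_Ici.mpr le_rfl) (Set.mem_Ici.mpr hl) hl
    have h0 : G 0 = 2 ^ Fintype.card ι := by simp [hG, hΨ]
    rw [h0] at h
    rw [Real.exp_neg, ← div_eq_mul_inv, le_div_iff₀ (Real.exp_pos _)]
    exact h
  set l := μ / (2 * Δ) with hl
  have hl0 : 0 ≤ l := by positivity
  have hmarkov : (#{s : Finset ι | Y s ≤ μ / 2} : ℝ) * Real.exp (-l * (μ / 2)) ≤ Ψ l := by
    calc (#{s : Finset ι | Y s ≤ μ / 2} : ℝ) * Real.exp (-l * (μ / 2))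
        = ∑ s with Y s ≤ μ / 2, Real.exp (-l * (μ / 2)) := by rw [sum_const, nsmul_eq_mul]
      _ ≤ ∑ s with Y s ≤ μ / 2, Real.exp (-l * Y s) := by
          refine sum_le_sum fun s hs => Real.exp_le_exp.mpr ?_
          have := (mem_filter.mp hs).2
          nlinarith
      _ ≤ Ψ l := sum_le_sum_of_subset_of_nonneg (filter_subset _ _)
          fun s _ _ => (Real.exp_pos _).le
  have h := hmarkov.trans (hΨbound l hl0)
  rw [← le_div_iff₀ (Real.exp_pos _), mul_div_assoc, ← Real.exp_sub] at h
  refine h.trans_eq ?_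
  congr 2
  rw [hl]
  field_simp
  ring

end

/-! ### Random assignments and spread families of terms -/

section

variable {ι α : Type*} [Fintype ι]

/-- The literals `(i, b)`, meaning "variable `i` has value `b`", that hold under `u`. A finset of
literals is read as a conjunction, so `B ⊆ literals u` says that `u` satisfies the term `B`. -/
def literals (u : ι → Bool) : Finset (ι × Bool) :=
  univ.filter fun l => u l.1 = l.2

theorem mem_literals {u : ι → Bool} {l : ι × Bool} : l ∈ literals u ↔ u l.1 = l.2 := by
  simp [literals]

theorem fst_injOn_literals (a : ι → Bool) : Set.InjOn Prod.fst (literals a : Set (ι × Bool)) := by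
  rintro ⟨i, b⟩ h ⟨j, c⟩ h' (rfl : i = j)
  rw [mem_coe, mem_literals] at h h'
  simp only at h h'
  rw [← h, ← h']

variable [DecidableEq ι]

/-- Assignments correspond to sets of variables via the set of agreement with a fixed `a`. -/
def agreeEquiv (a : ι → Bool) : (ι → Bool) ≃ Finset ι where
  toFun u := univ.filter fun i => u i = a i
  invFun s i := if i ∈ s then a i else !a i
  left_inv u := by
    funext i
    cases h : u i <;> cases h' : a i <;> simp [h, h']
  right_inv s := by
    ext i
    by_cases h : i ∈ s <;> simp [h]

theorem subset_literals_iff {a u : ι → Bool} {B : Finset (ι × Bool)} (hB : B ⊆ literals a) :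
    B ⊆ literals u ↔ B.image Prod.fst ⊆ agreeEquiv a u := by
  constructor
  · intro h i hi
    obtain ⟨l, hl, rfl⟩ := mem_image.mp hi
    simp only [agreeEquiv, Equiv.coe_fn_mk, mem_filter, mem_univ, true_and]
    rw [mem_literals.mp (h hl), mem_literals.mp (hB hl)]
  · intro h l hl
    have := h (mem_image_of_mem _ hl)
    simp only [agreeEquiv, Equiv.coe_fn_mk, mem_filter, mem_univ, true_and] at this
    rw [mem_literals, this, mem_literals.mp (hB hl)]

theorem card_image_fst {a : ι → Bool} {B : Finset (ι × Bool)} (hB : B ⊆ literals a) :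
    #(B.image Prod.fst) = #B :=
  card_image_of_injOn ((fst_injOn_literals a).mono (by exact_mod_cast hB))

theorem card_satisfying {a : ι → Bool} {B : Finset (ι × Bool)} (hB : B ⊆ literals a) :
    (#{u : ι → Bool | B ⊆ literals u} : ℝ) = 2 ^ Fintype.card ι / 2 ^ #B := by
  have h := sum_union_eq (B.image Prod.fst) (fun _ : Finset ι => (1 : ℝ))
  rw [card_image_fst hB] at h
  simp only [sum_const, nsmul_eq_mul, mul_one, card_univ, Fintype.card_finset] at h
  rw [eq_div_iff (by positivity), mul_comm]
  push_cast at h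
  rw [h]
  congr 2
  refine card_bij (fun u _ => agreeEquiv a u) (fun u hu => ?_)
    (fun u _ u' _ h => (agreeEquiv a).injective h) fun s hs => ?_
  · simpa [← subset_literals_iff hB] using hu
  · refine ⟨(agreeEquiv a).symm s, ?_, by simp⟩
    simpa [subset_literals_iff hB] using hs

theorem card_satisfying_le (B : Finset (ι × Bool)) :
    (#{u : ι → Bool | B ⊆ literals u} : ℝ) ≤ 2 ^ Fintype.card ι / 2 ^ #B := by
  by_cases h : ∃ a, B ⊆ literals a
  · obtain ⟨a, ha⟩ := h
    exact (card_satisfying ha).le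
  · push Not at h
    rw [filter_false_of_mem fun u _ => h u]
    simp only [card_empty, Nat.cast_zero]
    positivity

/-- The exponential moment of the size of the overlap of two independent members of a spread
family is close to `1`. -/
theorem sum_four_pow_card_inter_le {V : Type*} [DecidableEq V] [Fintype α] (B : α → Finset V)
    {D : ℕ} (hB : ∀ x, #(B x) ≤ D) (q : α → ℝ) (hq0 : ∀ x, 0 ≤ q x) (hq1 : ∑ x, q x = 1) {ρ : ℝ}
    (hρ : 0 ≤ ρ) (hs : ∀ T, ∑ x with T ⊆ B x, q x ≤ ρ ^ #T) :
    ∑ x, ∑ y, q x * q y * 4 ^ #(B x ∩ B y) ≤ (1 + 3 * ρ) ^ D := by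
  have h4 : ∀ x y, (4 : ℝ) ^ #(B x ∩ B y) =
      ∑ T ∈ (B x).powerset, if T ⊆ B y then 3 ^ #T else 0 := by
    intro x y
    have h := sum_pow_mul_eq_add_pow (3 : ℝ) 1 (B x ∩ B y)
    norm_num only [one_pow, mul_one] at h
    rw [← h, ← sum_filter]
    refine sum_congr ?_ fun _ _ => rfl
    ext T
    rw [mem_filter, mem_powerset, mem_powerset, subset_inter_iff]
  calc ∑ x, ∑ y, q x * q y * 4 ^ #(B x ∩ B y)
      = ∑ x, q x * ∑ T ∈ (B x).powerset, 3 ^ #T * ∑ y with T ⊆ B y, q y := by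
        refine sum_congr rfl fun x _ => ?_
        simp only [mul_assoc, ← mul_sum]
        congr 1
        simp only [h4, mul_sum]
        rw [sum_comm]
        refine sum_congr rfl fun T _ => ?_
        rw [sum_filter]
        refine sum_congr rfl fun y _ => ?_
        split_ifs <;> ring
    _ ≤ ∑ x, q x * (1 + 3 * ρ) ^ D := by
        refine sum_le_sum fun x _ => mul_le_mul_of_nonneg_left ?_ (hq0 x)
        calc ∑ T ∈ (B x).powerset, 3 ^ #T * ∑ y with T ⊆ B y, q y
            ≤ ∑ T ∈ (B x).powerset, (3 * ρ) ^ #T * 1 ^ (#(B x) - #T) := by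
              refine sum_le_sum fun T _ => ?_
              rw [one_pow, mul_one, mul_pow]
              exact mul_le_mul_of_nonneg_left (hs T) (by positivity)
          _ = (1 + 3 * ρ) ^ #(B x) := by rw [sum_pow_mul_eq_add_pow, add_comm]
          _ ≤ (1 + 3 * ρ) ^ D := pow_le_pow_right₀ (by linarith) (hB x)
    _ = (1 + 3 * ρ) ^ D := by rw [← sum_mul, hq1, one_mul]

/-- A random assignment satisfies a spread family of terms to a constant fraction of the expected
weight, except with exponentially small probability. Since terms with opposite literals are not
positively correlated, Janson's inequality is applied only to the terms compatible with one fixed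
assignment `a`; a second moment argument over a random `a` shows that some `a` retains a family of
the right mean and small correlations, once each term is given the extra weight `2 ^ |B x|`. -/
theorem spread_lower_tail [Fintype α] (B : α → Finset (ι × Bool))
    (hcons : ∀ x, ∃ u, B x ⊆ literals u) {D : ℕ} (hB : ∀ x, #(B x) ≤ D) (q : α → ℝ)
    (hq0 : ∀ x, 0 ≤ q x) (hq1 : ∑ x, q x = 1) {θ : ℝ} (hθ0 : 0 < θ) (hθ : θ ≤ 1 / 12)
    (hs : ∑ x, ∑ y, q x * q y * 4 ^ #(B x ∩ B y) ≤ 1 + θ) :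
    ∃ v : α → ℝ, (∀ x, 0 ≤ v x ∧ v x ≤ q x * 4 ^ D) ∧
      (#{u : ι → Bool | ∑ x with B x ⊆ literals u, v x ≤ 1 / 4} : ℝ) ≤
        2 ^ Fintype.card ι * Real.exp (-(1 / (96 * θ))) := by
  classical
  set N : ℝ := 2 ^ Fintype.card ι with hN
  have hNpos : 0 < N := by positivity
  set M : (ι → Bool) → ℝ := fun a => ∑ x, if B x ⊆ literals a then q x * 2 ^ #(B x) else 0 with hM
  set E : (ι → Bool) → ℝ := fun a => ∑ x, ∑ y, if B x ∪ B y ⊆ literals a then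
    (if Disjoint (B x) (B y) then 0 else
      q x * q y * 4 ^ #(B x) * 4 ^ #(B y) / 2 ^ #(B x ∪ B y)) else 0 with hE
  have hcardui : ∀ x y, #(B x) + #(B y) = #(B x ∪ B y) + #(B x ∩ B y) := fun x y =>
    (card_union_add_card_inter _ _).symm
  have hsumM : ∑ a, M a = N := by
    simp only [hM]
    rw [sum_comm]
    calc _ = ∑ x, q x * N := by
          refine sum_congr rfl fun x _ => ?_
          obtain ⟨u, hu⟩ := hcons x
          rw [← sum_filter, sum_const, nsmul_eq_mul, card_satisfying hu, ← hN]
          field_simp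
      _ = N := by rw [← sum_mul, hq1, one_mul]
  have hsumM2 : ∑ a, M a ^ 2 ≤ N * (1 + θ) := by
    have e : ∀ a, M a ^ 2 = ∑ x, ∑ y,
        if B x ∪ B y ⊆ literals a then q x * q y * 2 ^ (#(B x) + #(B y)) else 0 := by
      intro a
      rw [sq, hM, sum_mul_sum]
      refine sum_congr rfl fun x _ => sum_congr rfl fun y _ => ?_
      by_cases h1 : B x ⊆ literals a <;> by_cases h2 : B y ⊆ literals a <;>
        simp [union_subset_iff, h1, h2]
      ring
    simp only [e]
    rw [sum_comm]
    refine le_trans ?_ (mul_le_mul_of_nonneg_left hs hNpos.le)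
    rw [mul_sum]
    refine sum_le_sum fun x _ => ?_
    rw [sum_comm, mul_sum]
    refine sum_le_sum fun y _ => ?_
    rw [← sum_filter, sum_const, nsmul_eq_mul]
    have hq : 0 ≤ q x * q y := mul_nonneg (hq0 x) (hq0 y)
    calc _ ≤ N / 2 ^ #(B x ∪ B y) * (q x * q y * 2 ^ (#(B x) + #(B y))) :=
          mul_le_mul_of_nonneg_right (card_satisfying_le _) (by positivity)
      _ = N * (q x * q y * 2 ^ #(B x ∩ B y)) := by
          rw [hcardui, pow_add]
          field_simp
      _ ≤ N * (q x * q y * 4 ^ #(B x ∩ B y)) := by gcongr; norm_num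
  have hsumE : ∑ a, E a ≤ N * (2 * θ) := by
    simp only [hE]
    rw [sum_comm]
    have hs' : ∑ x, ∑ y, q x * q y * (4 ^ #(B x ∩ B y) - 1) ≤ θ := by
      have : ∑ x, ∑ y, q x * q y = 1 := by
        rw [← sum_mul_sum, hq1, one_mul]
      simp only [mul_sub, mul_one, sum_sub_distrib]
      rw [this]
      linarith
    calc _ ≤ ∑ x, ∑ y, N * (2 * (q x * q y * (4 ^ #(B x ∩ B y) - 1))) := by
          refine sum_le_sum fun x _ => ?_
          rw [sum_comm]
          refine sum_le_sum fun y _ => ?_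
          rw [← sum_filter, sum_const, nsmul_eq_mul]
          have hq : 0 ≤ q x * q y := mul_nonneg (hq0 x) (hq0 y)
          by_cases hd : Disjoint (B x) (B y)
          · simp [hd, disjoint_iff_inter_eq_empty.mp hd]
          · rw [if_neg hd]
            have h1 : 1 ≤ #(B x ∩ B y) := by
              rw [Nat.one_le_iff_ne_zero, Ne, card_eq_zero]
              exact fun h => hd (disjoint_iff_inter_eq_empty.mpr h)
            have h4 : (4 : ℝ) ≤ 4 ^ #(B x ∩ B y) := by
              calc (4 : ℝ) = 4 ^ 1 := by norm_num
                _ ≤ _ := pow_le_pow_right₀ (by norm_num) h1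
            calc _ ≤ N / 2 ^ #(B x ∪ B y) *
                  (q x * q y * 4 ^ #(B x) * 4 ^ #(B y) / 2 ^ #(B x ∪ B y)) :=
                  mul_le_mul_of_nonneg_right (card_satisfying_le _) (by positivity)
              _ = N * (q x * q y * (4 ^ #(B x ∪ B y) * 4 ^ #(B x ∩ B y)) /
                    (2 ^ #(B x ∪ B y) * 2 ^ #(B x ∪ B y))) := by
                  rw [← pow_add, ← hcardui, pow_add]
                  field_simp
              _ = N * (q x * q y * 4 ^ #(B x ∩ B y)) := by
                  rw [← mul_pow, show (2 : ℝ) * 2 = 4 by norm_num]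
                  field_simp
              _ ≤ _ := by
                  refine mul_le_mul_of_nonneg_left ?_ hNpos.le
                  nlinarith
      _ = N * (2 * ∑ x, ∑ y, q x * q y * (4 ^ #(B x ∩ B y) - 1)) := by
          simp only [mul_sum]
      _ ≤ N * (2 * θ) := by gcongr
  have hcardN : (#(univ : Finset (ι → Bool)) : ℝ) = N := by
    rw [card_univ, Fintype.card_fun, Fintype.card_bool]
    push_cast
    rfl
  obtain ⟨a, -, ha⟩ : ∃ a ∈ (univ : Finset (ι → Bool)), (M a - 1) ^ 2 + E a ≤ 3 * θ := by
    refine exists_le_of_sum_le ⟨fun _ => false, mem_univ _⟩ ?_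
    rw [sum_const, nsmul_eq_mul, hcardN]
    have : ∑ a, ((M a - 1) ^ 2 + E a) = ∑ a, M a ^ 2 - 2 * ∑ a, M a + N + ∑ a, E a := by
      rw [← hcardN, mul_sum, ← sum_sub_distrib, cast_card, ← sum_add_distrib, ← sum_add_distrib]
      refine sum_congr rfl fun a _ => ?_
      ring
    rw [this, hsumM]
    linarith
  have hEa : 0 ≤ E a := by
    refine sum_nonneg fun x _ => sum_nonneg fun y _ => ?_
    have hq : 0 ≤ q x * q y := mul_nonneg (hq0 x) (hq0 y)
    split_ifs <;> positivity
  have hMa : 1 / 2 ≤ M a := by nlinarith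
  have hEa' : E a ≤ 3 * θ := by nlinarith [sq_nonneg (M a - 1)]
  set v : α → ℝ := fun x => if B x ⊆ literals a then q x * 4 ^ #(B x) else 0 with hv
  have hv0 : ∀ x, 0 ≤ v x := fun x => by
    have := hq0 x
    simp only [hv]
    split_ifs <;> positivity
  refine ⟨v, fun x => ⟨hv0 x, ?_⟩, ?_⟩
  · have := hq0 x
    simp only [hv]
    split_ifs
    · exact mul_le_mul_of_nonneg_left (pow_le_pow_right₀ (by norm_num) (hB x)) this
    · positivity
  have hJ := janson_lower_tail (fun x => (B x).image Prod.fst) v hv0 (μ := M a) (Δ := 3 * θ)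
    (by linarith) ?_ (by positivity) (le_trans (le_of_eq ?_) hEa')
  · have hsub : (#{u : ι → Bool | ∑ x with B x ⊆ literals u, v x ≤ 1 / 4} : ℝ) ≤
        #{s : Finset ι | ∑ x with (B x).image Prod.fst ⊆ s, v x ≤ M a / 2} := by
      norm_cast
      refine card_le_card_of_injOn (agreeEquiv a) (fun u hu => ?_)
        (agreeEquiv a).injective.injOn
      simp only [coe_filter, mem_univ, true_and, Set.mem_ofPred_eq] at hu ⊢
      have e : ∑ x with (B x).image Prod.fst ⊆ agreeEquiv a u, v x =
          ∑ x with B x ⊆ literals u, v x := by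
        rw [sum_filter, sum_filter]
        refine sum_congr rfl fun x _ => ?_
        by_cases hx : B x ⊆ literals a
        · simp only [subset_literals_iff hx]
        · simp [hv, hx]
      rw [e]
      linarith
    refine hsub.trans (hJ.trans ?_)
    refine mul_le_mul_of_nonneg_left (Real.exp_le_exp.mpr (neg_le_neg ?_)) hNpos.le
    rw [div_le_div_iff₀ (by positivity) (by positivity)]
    nlinarith [mul_nonneg hθ0.le (sq_nonneg (M a - 1 / 2)), mul_nonneg hθ0.le (sub_nonneg.mpr hMa)]
  · simp only [hM]
    refine sum_congr rfl fun x _ => ?_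
    by_cases hx : B x ⊆ literals a
    · simp only [hv, hx, if_true, card_image_fst hx]
      rw [show (4 : ℝ) = 2 * 2 by norm_num, mul_pow]
      field_simp
    · simp [hv, hx]
  · simp only [hE]
    refine sum_congr rfl fun x _ => sum_congr rfl fun y _ => ?_
    by_cases hx : B x ⊆ literals a
    · by_cases hy : B y ⊆ literals a
      · have hxy := union_subset hx hy
        have hd : Disjoint ((B x).image Prod.fst) ((B y).image Prod.fst) ↔
            Disjoint (B x) (B y) := by
          rw [← card_union_eq_card_add_card, ← card_union_eq_card_add_card, ← image_union,
            card_image_fst hxy, card_image_fst hx, card_image_fst hy]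
        simp only [hv, hx, hy, hxy, if_true, hd, ← image_union, card_image_fst hxy]
        split_ifs
        · rfl
        · ring
      · simp [hv, hy, union_subset_iff]
    · simp [hv, hx, union_subset_iff]

/-- If `K` is a kernel of a family of terms, then almost no assignment satisfies `K` but only a
few terms of the family. -/
theorem IsKernel.card_few_satisfied_le [Fintype α] {A : α → Finset (ι × Bool)}
    (hcons : ∀ x, ∃ u, A x ⊆ literals u) {D : ℕ} (hD : 0 < D) (hA : ∀ x, #(A x) ≤ D)
    {H L : ℝ} {k : ℕ} (hH : 1 ≤ H) (hL0 : 0 < L) (hL : 4 * 4 ^ D * k ≤ L)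
    {K : Finset (ι × Bool)} (hK : IsKernel A L (3 * (1 / (1728 * D * H))) K) :
    (#{u : ι → Bool | K ⊆ literals u ∧ #{x | A x ⊆ literals u} ≤ k} : ℝ) ≤
      2 ^ Fintype.card ι * Real.exp (-H) := by
  classical
  obtain ⟨q, h0, h1, h2, h3, h4⟩ := hK
  have hD' : (1 : ℝ) ≤ D := by exact_mod_cast hD
  set ρ : ℝ := 3 * (1 / (1728 * D * H)) with hρ
  have hρ0 : 0 < ρ := by positivity
  have hx : 3 * ρ * D = 1 / (192 * H) := by
    rw [hρ]
    field_simp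
    norm_num
  have hs := sum_four_pow_card_inter_le (fun x => A x \ K) (D := D)
    (fun x => (card_le_card sdiff_subset).trans (hA x)) q h0 h1 hρ0.le (fun T => ?_)
  · have hexp : (1 + 3 * ρ) ^ D ≤ 1 + 1 / (96 * H) := by
      have hx1 : 1 / (192 * H) ≤ 1 := by
        rw [div_le_one (by positivity)]
        linarith
      have hx0 : 0 ≤ 1 / (192 * H) := by positivity
      have := Real.abs_exp_sub_one_le (x := 1 / (192 * H)) (by rwa [abs_of_nonneg hx0])
      rw [abs_of_nonneg hx0] at this
      calc (1 + 3 * ρ) ^ D ≤ Real.exp (3 * ρ) ^ D := by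
            refine pow_le_pow_left₀ (by positivity) ?_ _
            rw [add_comm]
            exact Real.add_one_le_exp _
        _ = Real.exp (1 / (192 * H)) := by
            rw [← Real.exp_nat_mul, mul_comm, hx]
        _ ≤ 1 + 2 * (1 / (192 * H)) := by linarith [le_abs_self (Real.exp (1 / (192 * H)) - 1)]
        _ = 1 + 1 / (96 * H) := by
            field_simp
            ring
    obtain ⟨v, hv, hcard⟩ := spread_lower_tail (fun x => A x \ K)
      (fun x => (hcons x).imp fun u hu => sdiff_subset.trans hu)
      (fun x => (card_le_card sdiff_subset).trans (hA x)) q h0 h1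
      (θ := 1 / (96 * H)) (by positivity)
      (by rw [div_le_div_iff₀ (by positivity) (by norm_num)]; linarith) (hs.trans hexp)
    have e : 1 / (96 * (1 / (96 * H))) = H := by field_simp
    rw [e] at hcard
    refine le_trans ?_ hcard
    norm_cast
    refine card_le_card fun u hu => ?_
    simp only [mem_filter, mem_univ, true_and] at hu ⊢
    obtain ⟨huK, huk⟩ := hu
    have huk' : (#{x | A x ⊆ literals u} : ℝ) ≤ k := by exact_mod_cast huk
    calc ∑ x with A x \ K ⊆ literals u, v x
        ≤ ∑ x with A x \ K ⊆ literals u, q x * 4 ^ D := sum_le_sum fun x _ => (hv x).2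
      _ ≤ ∑ x with A x ⊆ literals u, q x * 4 ^ D := by
          rw [sum_filter, sum_filter]
          refine sum_le_sum fun x _ => ?_
          by_cases hq : q x = 0
          · simp [hq]
          · have hKA := h3 x hq
            have : A x \ K ⊆ literals u ↔ A x ⊆ literals u := by
              refine ⟨fun h l hl => ?_, sdiff_subset.trans⟩
              by_cases hlK : l ∈ K
              · exact huK hlK
              · exact h (mem_sdiff.mpr ⟨hl, hlK⟩)
            simp only [this, le_refl]
      _ ≤ ∑ x with A x ⊆ literals u, 4 ^ D / L := by
          refine sum_le_sum fun x _ => ?_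
          rw [le_div_iff₀ hL0]
          have := h2 x
          have h4D : (0 : ℝ) < 4 ^ D := by positivity
          nlinarith
      _ ≤ 1 / 4 := by
          rw [sum_const, nsmul_eq_mul, ← mul_div_assoc, div_le_div_iff₀ hL0 (by norm_num)]
          have h4D : (0 : ℝ) < 4 ^ D := by positivity
          nlinarith [mul_le_mul_of_nonneg_right huk' h4D.le]
  · by_cases hT : Disjoint T K
    · refine le_trans (sum_le_sum_of_subset_of_nonneg ?_ fun x _ _ => h0 x) (h4 T hT)
      intro x hx
      simp only [mem_filter, mem_univ, true_and] at hx ⊢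
      exact hx.trans sdiff_subset
    · rw [filter_false_of_mem, sum_empty]
      · positivity
      · intro x _ hx
        exact hT (disjoint_of_subset_left hx disjoint_sdiff_self_left)

end

/-! ### Decision forests -/

/-- The literals read by a decision tree on input `u`. -/
def queryPath {m : ℕ} : DecisionTree m → (Fin m → Bool) → Finset (Fin m × Bool)
  | .leaf _, _ => ∅
  | .query i t₀ t₁, u =>
    insert (i, u i) (if u i = true then queryPath t₁ u else queryPath t₀ u)

theorem card_queryPath_le {m : ℕ} (T : DecisionTree m) (u : Fin m → Bool) :
    #(queryPath T u) ≤ T.depth := by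
  induction T with
  | leaf b => simp [queryPath]
  | query i t₀ t₁ h₀ h₁ =>
    rw [queryPath, DecisionTree.depth]
    refine (card_insert_le _ _).trans (Nat.succ_le_succ ?_)
    split_ifs
    · exact h₁.trans (le_max_right _ _)
    · exact h₀.trans (le_max_left _ _)

theorem queryPath_subset_literals {m : ℕ} (T : DecisionTree m) (u : Fin m → Bool) :
    queryPath T u ⊆ literals u := by
  induction T with
  | leaf b => simp [queryPath]
  | query i t₀ t₁ h₀ h₁ =>
    rw [queryPath, insert_subset_iff, mem_literals]
    refine ⟨rfl, ?_⟩
    split_ifs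
    · exact h₁
    · exact h₀

theorem queryPath_eq_of_subset {m : ℕ} (T : DecisionTree m) {u v : Fin m → Bool}
    (h : queryPath T u ⊆ literals v) : queryPath T v = queryPath T u ∧ T.eval v = T.eval u := by
  induction T with
  | leaf b => simp [queryPath, DecisionTree.eval]
  | query i t₀ t₁ h₀ h₁ =>
    rw [queryPath, insert_subset_iff, mem_literals] at h
    obtain ⟨hi, h⟩ := h
    simp only at hi
    simp only [queryPath, DecisionTree.eval, hi]
    split_ifs at h ⊢
    · exact ⟨by rw [(h₁ h).1], (h₁ h).2⟩
    · exact ⟨by rw [(h₀ h).1], (h₀ h).2⟩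

/-- For a decision forest of depth `D` there is a small set `J` of outputs such that an output
string of weight at most `k` is almost always supported in `J`. Here `J` consists of the outputs
having an accepting path that contains no minimal graded kernel; if an accepting path of another
output is followed, then some kernel is satisfied, and the weight is most likely larger. -/
theorem exists_small_support {m n D k : ℕ} {f : (Fin m → Bool) → (Fin n → Bool)} (hD : 0 < D)
    (hk : 1 ≤ k) (hf : HasDecisionDepth f D) {H : ℝ} (hH : 1 ≤ H) :
    ∃ J : Finset (Fin n), (#J : ℝ) ≤ 4 * k * (4 * (1728 * D ^ 2 * H)) ^ D ∧
      (#{u | weight (f u) ≤ k ∧ ∃ j ∉ J, f u j = true} : ℝ) ≤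
        2 ^ m * ((D + 1) * (1728 * D ^ 2 * H) ^ D * Real.exp (-H)) := by
  classical
  choose T hTd hTe using hf
  let α := {p : Fin n × Finset (Fin m × Bool) //
    ∃ u, f u p.1 = true ∧ queryPath (T p.1) u = p.2}
  let A : α → Finset (Fin m × Bool) := fun x => x.1.2
  have hA : ∀ x, #(A x) ≤ D := by
    rintro ⟨⟨j, B⟩, u, hu, hB⟩
    simp only at hB
    subst hB
    exact (card_queryPath_le _ _).trans (hTd j)
  have hcons : ∀ x, ∃ u, A x ⊆ literals u := by
    rintro ⟨⟨j, B⟩, u, hu, hB⟩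
    simp only at hB
    subst hB
    exact ⟨u, queryPath_subset_literals _ _⟩
  have hD' : (1 : ℝ) ≤ D := by exact_mod_cast hD
  have hk' : (1 : ℝ) ≤ k := by exact_mod_cast hk
  set r : ℝ := 1728 * D * H with hr
  set R : ℝ := 1728 * D ^ 2 * H with hR
  have hDH : 1 ≤ D * H := by nlinarith
  have hr1 : 1 ≤ r := by rw [hr, mul_assoc]; linarith
  have hRr : R = D / (1 / r) := by
    rw [hR, hr, div_div_eq_mul_div]
    ring
  have hrR : r ≤ R := by
    have : R = r * D := by rw [hR, hr]; ring
    rw [this]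
    nlinarith
  have hR1 : 1 ≤ R := hr1.trans hrR
  set L : ℝ := 4 * 4 ^ D * k with hL
  have hL0 : 0 < L := by positivity
  set P : Finset (Fin m × Bool) → Prop := IsGradedKernel A L (1 / r) D with hP
  set 𝒦 : Finset (Finset (Fin m × Bool)) := univ.filter fun K => Minimal P K with h𝒦
  have h𝒦D : ∀ K ∈ 𝒦, #K ≤ D := fun K hK => by
    obtain ⟨x, hx⟩ := IsKernel.exists_subset (mem_filter.mp hK).2.prop
    exact (card_le_card hx).trans (hA x)
  have h𝒦card : (#𝒦 : ℝ) ≤ (D + 1) * R ^ D := by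
    rw [card_eq_sum_card_fiberwise (f := card) (t := range (D + 1))
      (fun K hK => by simpa [Nat.lt_succ_iff] using h𝒦D K hK)]
    push_cast
    calc ∑ w ∈ range (D + 1), (#{K ∈ 𝒦 | #K = w} : ℝ) ≤ ∑ w ∈ range (D + 1), R ^ D := by
          refine sum_le_sum fun w hw => ?_
          have hwD : w ≤ D := Nat.lt_succ_iff.mp (mem_range.mp hw)
          refine (card_le_of_minimal_gradedKernel (A := A) (L := L) (ρ := 1 / r) (by positivity)
            hD hwD _ fun K hK => ?_).trans ?_
          · rw [mem_filter, h𝒦, mem_filter] at hK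
            exact ⟨hK.1.2, hK.2⟩
          · rw [← hRr]
            exact pow_le_pow_right₀ hR1 hwD
      _ = (D + 1) * R ^ D := by
          rw [sum_const, card_range, nsmul_eq_mul]
          push_cast
          rfl
  set s : Finset α := univ.filter fun x => ∀ K ∈ 𝒦, ¬ K ⊆ A x with hs
  refine ⟨s.image fun x => x.1.1, ?_, ?_⟩
  · have hsL : (#s : ℝ) ≤ L * r ^ D := by
      by_contra! hlt
      obtain ⟨K, hK, x, hx, hKx⟩ := exists_isKernel_of_card A s hA hL0 hr1 hlt
      have hKP : P K := by
        refine hK.mono (by positivity) (le_mul_of_one_le_right (by positivity) (one_le_pow₀ ?_))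
        have : 0 < 1 / (D : ℝ) := by positivity
        linarith
      obtain ⟨K', hle, hmin⟩ := (Set.toFinite {K | P K}).exists_le_minimal hKP
      exact (mem_filter.mp hx).2 K' (mem_filter.mpr ⟨mem_univ _, hmin⟩) (hle.trans hKx)
    calc (#(s.image fun x => x.1.1) : ℝ) ≤ #s := by exact_mod_cast card_image_le
      _ ≤ L * r ^ D := hsL
      _ ≤ L * R ^ D := by gcongr
      _ = 4 * k * (4 * R) ^ D := by
          rw [hL, mul_pow 4 R]
          ring
  · have hsub : (univ.filter fun u => weight (f u) ≤ k ∧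
        ∃ j ∉ s.image fun x => x.1.1, f u j = true) ⊆
        𝒦.biUnion fun K =>
          univ.filter fun u => K ⊆ literals u ∧ #{x | A x ⊆ literals u} ≤ k := by
      intro u hu
      obtain ⟨hw, j, hj, hfj⟩ := (mem_filter.mp hu).2
      let x : α := ⟨(j, queryPath (T j) u), u, hfj, rfl⟩
      have hxs : x ∉ s := fun hx => hj (mem_image_of_mem (fun x : α => x.1.1) hx)
      simp only [hs, mem_filter, mem_univ, true_and, not_forall, not_not] at hxs
      obtain ⟨K, hK, hKx⟩ := hxs
      refine mem_biUnion.mpr ⟨K, hK, mem_filter.mpr ⟨mem_univ _, ?_, le_trans ?_ hw⟩⟩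
      · exact hKx.trans (queryPath_subset_literals _ _)
      · have key : ∀ y : α, A y ⊆ literals u →
            f u y.1.1 = true ∧ y.1.2 = queryPath (T y.1.1) u := by
          rintro ⟨⟨i, B⟩, v, hv, hB⟩ hy
          simp only at hv hB ⊢
          subst hB
          obtain ⟨h1, h2⟩ := queryPath_eq_of_subset (T i) hy
          rw [hTe, hTe] at h2
          exact ⟨h2.trans hv, h1.symm⟩
        refine card_le_card_of_injOn (fun y => y.1.1) (fun y hy => ?_) fun y hy z hz hyz => ?_
        · have := (key y (by simpa using hy)).1
          simpa using this
        · have h1 := (key y (by simpa using hy)).2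
          have h2 := (key z (by simpa using hz)).2
          simp only at hyz
          exact Subtype.ext (Prod.ext hyz (by rw [h1, h2, hyz]))
    calc (#(univ.filter fun u => weight (f u) ≤ k ∧
            ∃ j ∉ s.image fun x => x.1.1, f u j = true) : ℝ)
        ≤ ∑ K ∈ 𝒦, (#(univ.filter fun u : Fin m → Bool =>
            K ⊆ literals u ∧ #{x | A x ⊆ literals u} ≤ k) : ℝ) := by
          exact_mod_cast (card_le_card hsub).trans card_biUnion_le
      _ ≤ ∑ K ∈ 𝒦, 2 ^ m * Real.exp (-H) := by
          refine sum_le_sum fun K hK => ?_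
          have hker : IsKernel A L (3 * (1 / r)) K :=
            IsGradedKernel.isKernel_three (by positivity) hD (mem_filter.mp hK).2.prop
          have := hker.card_few_satisfied_le hcons hD hA hH hL0 le_rfl
          rwa [Fintype.card_fin] at this
      _ = 2 ^ m * Real.exp (-H) * #𝒦 := by rw [sum_const, nsmul_eq_mul, mul_comm]
      _ ≤ 2 ^ m * Real.exp (-H) * ((D + 1) * R ^ D) := by gcongr
      _ = _ := by ring


/-! ### Statistical distance from a union of slices -/

theorem sum_toReal_eq_one {α : Type} [Fintype α] (P : PMF α) : ∑ a, (P a).toReal = 1 := by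
  rw [← ENNReal.toReal_sum fun a _ => P.apply_ne_top a, ← tsum_fintype (L := .unconditional α),
    P.tsum_coe, ENNReal.toReal_one]

theorem sum_sub_sum_le_statDist {α : Type} [Fintype α] [DecidableEq α] (P Q : PMF α)
    (E : Finset α) : ∑ a ∈ E, (Q a).toReal - ∑ a ∈ E, (P a).toReal ≤ statDist P Q := by
  have hP := sum_toReal_eq_one P
  have hQ := sum_toReal_eq_one Q
  rw [← sum_add_sum_compl E] at hP hQ
  have h1 : ∑ a ∈ E, (Q a).toReal - ∑ a ∈ E, (P a).toReal ≤
      ∑ a ∈ E, |(P a).toReal - (Q a).toReal| := by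
    rw [← sum_sub_distrib]
    refine sum_le_sum fun a _ => ?_
    rw [abs_sub_comm]
    exact le_abs_self _
  have h2 : ∑ a ∈ Eᶜ, (P a).toReal - ∑ a ∈ Eᶜ, (Q a).toReal ≤
      ∑ a ∈ Eᶜ, |(P a).toReal - (Q a).toReal| := by
    rw [← sum_sub_distrib]
    exact sum_le_sum fun a _ => le_abs_self _
  rw [statDist, ← sum_add_sum_compl E]
  linarith

theorem toReal_outputDist {m n : ℕ} (f : (Fin m → Bool) → (Fin n → Bool)) (y : Fin n → Bool) :
    (outputDist f y).toReal = #{u | f u = y} / 2 ^ m := by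
  classical
  rw [outputDist, PMF.map_apply, tsum_fintype]
  simp only [PMF.uniformOfFintype_apply]
  rw [← sum_filter, sum_const, nsmul_eq_mul, ENNReal.toReal_mul, ENNReal.toReal_natCast,
    ENNReal.toReal_inv, ENNReal.toReal_natCast, Fintype.card_fun, Fintype.card_bool,
    Fintype.card_fin, div_eq_mul_inv]
  push_cast
  congr 3
  ext u
  simp [eq_comm]

theorem sum_toReal_outputDist {m n : ℕ} (f : (Fin m → Bool) → (Fin n → Bool))
    (E : Finset (Fin n → Bool)) :
    ∑ y ∈ E, (outputDist f y).toReal = #{u | f u ∈ E} / 2 ^ m := by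
  simp only [toReal_outputDist]
  rw [← sum_div, card_eq_sum_card_fiberwise (f := f) (t := E) (fun u hu => by simpa using hu)]
  push_cast
  congr 1
  refine sum_congr rfl fun y hy => ?_
  rw [filter_filter]
  congr 2
  ext u
  simp only [mem_filter, mem_univ, true_and]
  constructor
  · rintro rfl; exact ⟨hy, rfl⟩
  · exact And.right

theorem mem_stringsOfWeight {n : ℕ} {S : Set ℕ} {y : Fin n → Bool} :
    y ∈ stringsOfWeight n S ↔ weight y ∈ S := by
  simp [stringsOfWeight]

theorem toReal_uniformUnion {n : ℕ} (S : Set ℕ) (hS : ∃ k ∈ S, k ≤ n) (y : Fin n → Bool) :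
    (uniformUnion n S hS y).toReal =
      if y ∈ stringsOfWeight n S then 1 / (#(stringsOfWeight n S) : ℝ) else 0 := by
  classical
  rw [uniformUnion, PMF.uniformOfFinset_apply]
  split_ifs <;> simp

theorem one_sub_le_statDist {m n : ℕ} (f : (Fin m → Bool) → (Fin n → Bool)) (S : Set ℕ)
    (hS : ∃ k ∈ S, k ≤ n) (E : Finset (Fin n → Bool)) :
    1 - (#{y ∈ stringsOfWeight n S | y ∉ E} : ℝ) / #(stringsOfWeight n S) -
      (#{u | f u ∈ E} : ℝ) / 2 ^ m ≤ statDist (outputDist f) (uniformUnion n S hS) := by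
  classical
  refine le_trans (le_of_eq ?_) (sum_sub_sum_le_statDist _ _ E)
  have hpos : (0 : ℝ) < #(stringsOfWeight n S) := by
    exact_mod_cast (stringsOfWeight_nonempty n S hS).card_pos
  rw [sum_toReal_outputDist]
  congr 1
  simp only [toReal_uniformUnion]
  rw [← sum_filter, sum_const, nsmul_eq_mul, mul_one_div, one_sub_div hpos.ne']
  congr 1
  have h := card_filter_add_card_filter_not (s := stringsOfWeight n S) (fun y => y ∈ E)
  have e : {y ∈ E | y ∈ stringsOfWeight n S} = {y ∈ stringsOfWeight n S | y ∈ E} := by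
    ext; simp [and_comm]
  rw [e, ← h]
  push_cast
  ring

/-- The main estimate: a union of slices of weight at most `k` is far from every distribution
sampled with depth `D`, up to its mass on the strings supported in some small set `J`. -/
theorem exists_one_sub_le_statDist {m n D k : ℕ} {f : (Fin m → Bool) → (Fin n → Bool)}
    (hD : 0 < D) (hk : 1 ≤ k) (hf : HasDecisionDepth f D) {H : ℝ} (hH : 1 ≤ H) (S : Set ℕ)
    (hS : ∃ k ∈ S, k ≤ n) (hSk : ∀ w ∈ S, w ≤ k) :
    ∃ J : Finset (Fin n), (#J : ℝ) ≤ 4 * k * (4 * (1728 * D ^ 2 * H)) ^ D ∧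
      1 - (#{y ∈ stringsOfWeight n S | ∀ j, y j = true → j ∈ J} : ℝ) / #(stringsOfWeight n S) -
        (D + 1) * (1728 * D ^ 2 * H) ^ D * Real.exp (-H) ≤
          statDist (outputDist f) (uniformUnion n S hS) := by
  classical
  obtain ⟨J, hJ, hcard⟩ := exists_small_support hD hk hf hH
  refine ⟨J, hJ, le_trans ?_ (one_sub_le_statDist f S hS
    (univ.filter fun y => weight y ≤ k ∧ ∃ j ∉ J, y j = true))⟩
  have h1 : {y ∈ stringsOfWeight n S | ∀ j, y j = true → j ∈ J} =
      {y ∈ stringsOfWeight n S |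
        y ∉ univ.filter fun y => weight y ≤ k ∧ ∃ j ∉ J, y j = true} := by
    refine filter_congr fun y hy => ?_
    have hw := hSk _ (mem_stringsOfWeight.mp hy)
    simp only [mem_filter, mem_univ, true_and, hw, not_exists, not_and]
    exact forall_congr' fun j => ⟨fun h hj hy => hj (h hy), fun h hy => by_contra fun hj => h hj hy⟩
  rw [h1]
  refine sub_le_sub_left ?_ _
  rw [div_le_iff₀ (by positivity), mul_comm]
  simpa using hcard

/-! ### Counting strings in slices -/

theorem card_weight_eq_supported {n : ℕ} (J : Finset (Fin n)) (w : ℕ) :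
    #{y : Fin n → Bool | weight y = w ∧ ∀ j, y j = true → j ∈ J} = (#J).choose w := by
  rw [← card_powersetCard]
  refine card_bij (fun y _ => univ.filter fun j => y j = true) (fun y hy => ?_)
    (fun y _ z _ h => ?_) fun B hB => ?_
  · obtain ⟨h1, h2⟩ := (mem_filter.mp hy).2
    rw [mem_powersetCard]
    exact ⟨fun j hj => h2 j (mem_filter.mp hj).2, h1⟩
  · funext j
    have := Finset.ext_iff.mp h j
    simp only [mem_filter, mem_univ, true_and] at this
    exact Bool.eq_iff_iff.mpr this
  · rw [mem_powersetCard] at hB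
    refine ⟨fun j => decide (j ∈ B), mem_filter.mpr ⟨mem_univ _, ?_, ?_⟩, ?_⟩
    · simpa [weight] using hB.2
    · exact fun j hj => hB.1 (by simpa using hj)
    · ext j; simp

theorem card_weight_eq (n w : ℕ) : #{y : Fin n → Bool | weight y = w} = n.choose w := by
  have := card_weight_eq_supported (univ : Finset (Fin n)) w
  simpa using this

theorem choose_mul_pow_le {N n : ℕ} (h : N ≤ n) (w : ℕ) :
    N.choose w * n ^ w ≤ N ^ w * n.choose w := by
  have hd : N.descFactorial w * n ^ w ≤ N ^ w * n.descFactorial w := by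
    induction w with
    | zero => simp
    | succ w ih =>
      rw [Nat.descFactorial_succ, Nat.descFactorial_succ, pow_succ, pow_succ]
      have h2 : (N - w) * n ≤ N * (n - w) := by
        rw [Nat.sub_mul, Nat.mul_sub]
        have := Nat.mul_le_mul_left w h
        rw [mul_comm N w]
        omega
      calc (N - w) * N.descFactorial w * (n ^ w * n)
          = (N.descFactorial w * n ^ w) * ((N - w) * n) := by ring
        _ ≤ (N ^ w * n.descFactorial w) * (N * (n - w)) := Nat.mul_le_mul ih h2
        _ = _ := by ring
  rw [Nat.descFactorial_eq_factorial_mul_choose, Nat.descFactorial_eq_factorial_mul_choose] at hd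
  refine Nat.le_of_mul_le_mul_left ?_ w.factorial_pos
  calc _ = _ := by ring
    _ ≤ _ := hd
    _ = _ := by ring

theorem le_choose {n k : ℕ} (hk : 1 ≤ k) (hkn : 2 * k ≤ n) : n ≤ n.choose k := by
  induction k, hk using Nat.le_induction with
  | base => simp
  | succ k hk ih =>
    exact (ih (by omega)).trans (Nat.choose_le_succ_of_lt_half_left (by omega))

theorem card_slice_supported_div_le {n k : ℕ} (hk : k ≤ n) (J : Finset (Fin n)) :
    (#{y ∈ stringsOfWeight n {k} | ∀ j, y j = true → j ∈ J} : ℝ) / #(stringsOfWeight n {k}) ≤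
      ((#J : ℝ) / n) ^ k := by
  have e1 : stringsOfWeight n {k} = univ.filter fun y => weight y = k := by
    ext y; simp [mem_stringsOfWeight]
  rw [e1, filter_filter, card_weight_eq_supported, card_weight_eq, div_pow]
  rcases Nat.eq_zero_or_pos n with rfl | hn
  · obtain rfl : k = 0 := by omega
    simp
  have hc : (0 : ℝ) < n.choose k := by exact_mod_cast Nat.choose_pos hk
  rw [div_le_div_iff₀ hc (by positivity)]
  have hJ : #J ≤ n := by simpa using card_le_univ J
  exact_mod_cast choose_mul_pow_le hJ k

theorem le_card_stringsOfWeight {n k : ℕ} {S : Set ℕ} (hkS : k ∈ S) (hk : 1 ≤ k)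
    (hkn : 2 * k ≤ n) : n ≤ #(stringsOfWeight n S) := by
  refine (le_choose hk hkn).trans ?_
  rw [← card_weight_eq]
  refine card_le_card fun y hy => ?_
  rw [mem_stringsOfWeight, (mem_filter.mp hy).2]
  exact hkS

theorem card_supported_div_le {n k : ℕ} {S : Set ℕ} (hkS : k ∈ S) (hk : 1 ≤ k) (hkn : 2 * k ≤ n)
    (J : Finset (Fin n)) :
    (#{y ∈ stringsOfWeight n S | ∀ j, y j = true → j ∈ J} : ℝ) / #(stringsOfWeight n S) ≤
      (#J : ℝ) / n + 1 / n := by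
  classical
  have hn : 0 < n := by omega
  have hge := le_card_stringsOfWeight hkS hk hkn
  have hJ : #J ≤ n := by simpa using card_le_univ J
  have hmaps : ∀ y : Fin n → Bool, weight y ∈ range (n + 1) := fun y => by
    rw [mem_range, Nat.lt_succ_iff, weight]
    simpa using card_le_univ (univ.filter fun i => y i = true)
  have main : #{y ∈ stringsOfWeight n S | ∀ j, y j = true → j ∈ J} * n ≤
      #J * #(stringsOfWeight n S) + n := by
    rw [card_eq_sum_card_fiberwise (f := weight) (t := range (n + 1)) (fun y _ => hmaps y),
      card_eq_sum_card_fiberwise (s := stringsOfWeight n S) (f := weight) (t := range (n + 1))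
        (fun y _ => hmaps y), sum_mul, mul_sum]
    have hsum : ∑ w ∈ range (n + 1), (if w = 0 then n else 0) = n := by simp
    refine le_trans ?_ (Nat.add_le_add_left hsum.le _)
    rw [← sum_add_distrib]
    refine sum_le_sum fun w _ => ?_
    by_cases hw : w ∈ S
    · have e1 : {y ∈ {y ∈ stringsOfWeight n S | ∀ j, y j = true → j ∈ J} | weight y = w} =
          univ.filter fun y => weight y = w ∧ ∀ j, y j = true → j ∈ J := by
        ext y
        simp only [mem_filter, mem_stringsOfWeight, mem_univ, true_and]
        constructor
        · tauto
        · rintro ⟨rfl, h⟩; exact ⟨⟨hw, h⟩, rfl⟩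
      have e2 : {y ∈ stringsOfWeight n S | weight y = w} = univ.filter fun y => weight y = w := by
        ext y
        simp only [mem_filter, mem_stringsOfWeight, mem_univ, true_and]
        constructor
        · tauto
        · rintro rfl; exact ⟨hw, rfl⟩
      rw [e1, e2, card_weight_eq_supported, card_weight_eq]
      rcases Nat.eq_zero_or_pos w with rfl | hw0
      · simp
      · rw [if_neg hw0.ne', add_zero]
        obtain ⟨w, rfl⟩ : ∃ v, w = v + 1 := ⟨w - 1, by omega⟩
        have h1 := choose_mul_pow_le hJ (w + 1)
        refine Nat.le_of_mul_le_mul_left ?_ (pow_pos hn w)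
        calc n ^ w * ((#J).choose (w + 1) * n) = (#J).choose (w + 1) * n ^ (w + 1) := by ring
          _ ≤ #J ^ (w + 1) * n.choose (w + 1) := h1
          _ = #J ^ w * (#J * n.choose (w + 1)) := by ring
          _ ≤ n ^ w * (#J * n.choose (w + 1)) :=
            Nat.mul_le_mul_right _ (Nat.pow_le_pow_left hJ w)
    · rw [filter_eq_empty_iff.mpr]
      · simp
      · intro y hy h
        exact hw (h ▸ mem_stringsOfWeight.mp (mem_filter.mp hy).1)
  have hn' : (0 : ℝ) < n := by exact_mod_cast hn
  have hge' : (n : ℝ) ≤ #(stringsOfWeight n S) := by exact_mod_cast hge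
  rw [← add_div, div_le_div_iff₀ (by linarith) hn']
  have main' : (#{y ∈ stringsOfWeight n S | ∀ j, y j = true → j ∈ J} : ℝ) * n ≤
      #J * #(stringsOfWeight n S) + n := by exact_mod_cast main
  linarith

/-- Without queries the output is constant. -/
theorem one_sub_one_div_le_statDist {m n k : ℕ} {f : (Fin m → Bool) → (Fin n → Bool)}
    (hf : HasDecisionDepth f 0) {S : Set ℕ} (hS : ∃ k ∈ S, k ≤ n) (hkS : k ∈ S) (hk : 1 ≤ k)
    (hkn : 2 * k ≤ n) : 1 - 1 / (n : ℝ) ≤ statDist (outputDist f) (uniformUnion n S hS) := by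
  classical
  have hconst : ∀ u v, f u = f v := by
    intro u v
    funext j
    obtain ⟨T, hT, he⟩ := hf j
    rw [← he u, ← he v]
    cases T with
    | leaf b => rfl
    | query i t₀ t₁ => simp [DecisionTree.depth] at hT
  refine le_trans ?_ (one_sub_le_statDist f S hS (univ.erase (f fun _ => false)))
  have h1 : #{y ∈ stringsOfWeight n S | y ∉ univ.erase (f fun _ => false)} ≤ 1 := by
    refine card_le_one.mpr fun y hy z hz => ?_
    simp only [mem_filter, mem_erase, mem_univ, and_true, not_not] at hy hz
    rw [hy.2, hz.2]
  have h2 : (univ.filter fun u => f u ∈ univ.erase (f fun _ => false)) = ∅ := by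
    refine filter_false_of_mem fun u _ => ?_
    simp [hconst u fun _ => false]
  have h3 : (n : ℝ) ≤ #(stringsOfWeight n S) := by
    exact_mod_cast le_card_stringsOfWeight hkS hk hkn
  have hn : (0 : ℝ) < n := by
    have : 0 < n := by omega
    exact_mod_cast this
  rw [h2, card_empty, Nat.cast_zero, zero_div, sub_zero]
  refine sub_le_sub_left (div_le_div₀ zero_le_one (by exact_mod_cast h1) hn h3) _

/-! ### Complementing the output -/

theorem exists_eval_not {m : ℕ} (T : DecisionTree m) :
    ∃ T' : DecisionTree m, T'.depth = T.depth ∧ ∀ x, T'.eval x = !T.eval x := by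
  induction T with
  | leaf b => exact ⟨.leaf !b, rfl, fun _ => rfl⟩
  | query i t₀ t₁ h₀ h₁ =>
    obtain ⟨s₀, d₀, e₀⟩ := h₀
    obtain ⟨s₁, d₁, e₁⟩ := h₁
    refine ⟨.query i s₀ s₁, by simp [DecisionTree.depth, d₀, d₁], fun x => ?_⟩
    simp only [DecisionTree.eval, e₀, e₁]
    split_ifs <;> rfl

/-- Flipping every bit of a string. -/
def complEquiv (n : ℕ) : (Fin n → Bool) ≃ (Fin n → Bool) where
  toFun y := fun j => !y j
  invFun y := fun j => !y j
  left_inv y := by simp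
  right_inv y := by simp

theorem weight_complEquiv {n : ℕ} (y : Fin n → Bool) :
    weight (complEquiv n y) + weight y = n := by
  have h := card_filter_add_card_filter_not (s := (univ : Finset (Fin n))) (fun i => y i = true)
  rw [card_univ, Fintype.card_fin] at h
  rw [add_comm]
  have e : weight (complEquiv n y) = #{i | ¬ y i = true} := by
    rw [weight]
    congr 1
    ext i
    simp [complEquiv]
  rw [e]
  exact h

theorem CanSample.compl {n d : ℕ} {η : ℝ} {S : Set ℕ} {hS : ∃ k ∈ S, k ≤ n}
    (h : CanSample (uniformUnion n S hS) d η) (hS' : ∃ k ∈ {w | w ≤ n ∧ n - w ∈ S}, k ≤ n) :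
    CanSample (uniformUnion n {w | w ≤ n ∧ n - w ∈ S} hS') d η := by
  classical
  obtain ⟨m, f, hf, rfl⟩ := h
  refine ⟨m, fun u => complEquiv n (f u), fun j => ?_, ?_⟩
  · obtain ⟨T, hT, he⟩ := hf j
    obtain ⟨T', hd, he'⟩ := exists_eval_not T
    exact ⟨T', hd.trans_le hT, fun x => by rw [he', he]; rfl⟩
  · have hmem : ∀ y, complEquiv n y ∈ stringsOfWeight n {w | w ≤ n ∧ n - w ∈ S} ↔
        y ∈ stringsOfWeight n S := by
      intro y
      have := weight_complEquiv y
      rw [mem_stringsOfWeight, mem_stringsOfWeight, Set.mem_ofPred_eq,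
        show n - weight (complEquiv n y) = weight y by omega]
      exact and_iff_right (by omega)
    have hcard : #(stringsOfWeight n {w | w ≤ n ∧ n - w ∈ S}) = #(stringsOfWeight n S) :=
      (card_bij (fun y _ => complEquiv n y) (fun y hy => (hmem y).mpr hy)
        (fun y _ z _ h => (complEquiv n).injective h) fun z hz =>
          ⟨(complEquiv n).symm z, (hmem _).mp (by simpa using hz), by simp⟩).symm
    rw [statDist, statDist, ← (complEquiv n).sum_comp]
    congr 1
    refine sum_congr rfl fun y _ => ?_
    simp only [toReal_outputDist, toReal_uniformUnion, hmem, hcard, EmbeddingLike.apply_eq_iff_eq]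


/-! ### Choice of parameters -/

theorem exp_neg_le_two_rpow_neg {x : ℝ} (hx : 0 ≤ x) : Real.exp (-x) ≤ (2 : ℝ) ^ (-x) := by
  rw [Real.rpow_def_of_pos two_pos]
  refine Real.exp_le_exp.mpr ?_
  have := Real.log_two_lt_d9
  nlinarith

theorem two_rpow_neg_le_div {x : ℝ} (hx : 0 < x) : (2 : ℝ) ^ (-x) ≤ 2 / x := by
  rw [Real.rpow_def_of_pos two_pos, mul_neg, Real.exp_neg, inv_eq_one_div,
    div_le_div_iff₀ (Real.exp_pos _) hx]
  have h1 := Real.add_one_le_exp (Real.log 2 * x)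
  have h2 := Real.log_two_gt_d9
  nlinarith

theorem base_pow_le_two_rpow {D : ℕ} {z H y : ℝ} (hz : 2 ≤ z) (hDz : (D : ℝ) ≤ z) (hH0 : 0 ≤ H)
    (hH : H ≤ z ^ 2) (hy : D * Real.logb 2 z ≤ y) :
    (4 * (1728 * (D : ℝ) ^ 2 * H)) ^ D ≤ (2 : ℝ) ^ (17 * y) := by
  have hz0 : 0 < z := by linarith
  have h1 : 4 * (1728 * (D : ℝ) ^ 2 * H) ≤ z ^ 17 := by
    have h2 : (2 : ℝ) ^ 13 ≤ z ^ 13 := pow_le_pow_left₀ (by norm_num) hz 13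
    calc 4 * (1728 * (D : ℝ) ^ 2 * H) = 6912 * ((D : ℝ) ^ 2 * H) := by ring
      _ ≤ z ^ 13 * (z ^ 2 * z ^ 2) := by
          refine mul_le_mul (by linarith) ?_ (by positivity) (by positivity)
          exact mul_le_mul (pow_le_pow_left₀ (by positivity) hDz 2) hH hH0 (by positivity)
      _ = z ^ 17 := by ring
  calc (4 * (1728 * (D : ℝ) ^ 2 * H)) ^ D ≤ (z ^ 17) ^ D :=
        pow_le_pow_left₀ (by positivity) h1 _
    _ = (2 : ℝ) ^ (17 * (D * Real.logb 2 z)) := by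
        rw [← pow_mul]
        conv_lhs => rw [← Real.rpow_logb two_pos (by norm_num) hz0]
        rw [← Real.rpow_natCast, ← Real.rpow_mul two_pos.le]
        congr 1
        push_cast
        ring
    _ ≤ _ := Real.rpow_le_rpow_of_exponent_le one_le_two (by linarith)

theorem succ_mul_pow_le {D : ℕ} {R : ℝ} (hR : 0 ≤ R) : ((D : ℝ) + 1) * R ^ D ≤ (4 * R) ^ D := by
  rw [mul_pow]
  refine mul_le_mul_of_nonneg_right ?_ (by positivity)
  have h1 : D + 1 ≤ 2 ^ D := Nat.lt_two_pow_self
  have h2 : (D : ℝ) + 1 ≤ 2 ^ D := by exact_mod_cast h1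
  exact h2.trans (pow_le_pow_left₀ (by norm_num) (by norm_num) D)

/-- The bound for unions of slices with largest weight `k`. For `d ≥ 1` the hypothesis on `d`
forces `n / k` to be large in terms of `τ`. -/
theorem one_sub_le_of_canSample_of_isGreatest {ε : ℝ} (hε : 0 < ε) {n k d : ℕ} {η : ℝ} {S : Set ℕ}
    {hS : ∃ w ∈ S, w ≤ n} (hSk : IsGreatest S k) (hn : ⌈2 / ε⌉₊ ≤ n) (hk : 1 ≤ k)
    (hkn : 4 * k ≤ n)
    (hd : (d : ℝ) ≤ min (1 / 34) (ε / 40) * Real.logb 2 (n / k) /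
      Real.logb 2 (Real.logb 2 (n / k)))
    (h : CanSample (uniformUnion n S hS) d η) : 1 - ε ≤ η := by
  obtain ⟨m, f, hf, rfl⟩ := h
  have hk' : (1 : ℝ) ≤ k := by exact_mod_cast hk
  have hkn' : 4 * (k : ℝ) ≤ n := by exact_mod_cast hkn
  have hn0 : (0 : ℝ) < n := by linarith
  have hinv : 1 / (n : ℝ) ≤ ε / 2 := by
    have h1 : 2 / ε ≤ n := (Nat.le_ceil _).trans (by exact_mod_cast hn)
    rw [div_le_iff₀ hε] at h1
    rw [div_le_div_iff₀ hn0 two_pos]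
    linarith
  rcases Nat.eq_zero_or_pos d with rfl | hd0
  · have := one_sub_one_div_le_statDist hf hS hSk.1 hk (by omega)
    linarith
  set x := Real.logb 2 ((n : ℝ) / k) with hx
  set τ := min (1 / 34) (ε / 40) with hτ
  have hτ0 : 0 < τ := by positivity
  have hτ1 : τ ≤ 1 / 34 := min_le_left _ _
  have hτ2 : τ ≤ ε / 40 := min_le_right _ _
  have hnk : (4 : ℝ) ≤ n / k := by rwa [le_div_iff₀ (by linarith)]
  have hx2 : 2 ≤ x := by
    rw [hx, Real.le_logb_iff_rpow_le one_lt_two (by linarith)]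
    norm_num
    exact hnk
  have hpow : (2 : ℝ) ^ x = n / k := Real.rpow_logb two_pos (by norm_num) (by linarith)
  have hlx : 1 ≤ Real.logb 2 x := by
    rw [Real.le_logb_iff_rpow_le one_lt_two (by linarith)]
    simpa using hx2
  have hdx : d * Real.logb 2 x ≤ τ * x := by
    rwa [le_div_iff₀ (by linarith)] at hd
  have hd1 : (1 : ℝ) ≤ d := by exact_mod_cast hd0
  have hdτ : (d : ℝ) ≤ τ * x := by nlinarith
  have hτx : 1 ≤ τ * x := hd1.trans hdτ
  obtain ⟨J, hJ, hdist⟩ := exists_one_sub_le_statDist hd0 hk hf (H := x) (by linarith) S hS hSk.2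
  have hQ : (4 * (1728 * (d : ℝ) ^ 2 * x)) ^ d ≤ (2 : ℝ) ^ (x / 2) :=
    (base_pow_le_two_rpow hx2 (by nlinarith) (by linarith) (by nlinarith) hdx).trans
      (Real.rpow_le_rpow_of_exponent_le one_le_two (by nlinarith))
  have hM : ((d : ℝ) + 1) * (1728 * d ^ 2 * x) ^ d * Real.exp (-x) ≤ 2 ^ (-(x / 2)) := by
    calc _ ≤ (2 : ℝ) ^ (x / 2) * 2 ^ (-x) :=
          mul_le_mul ((succ_mul_pow_le (by positivity)).trans hQ)
            (exp_neg_le_two_rpow_neg (by linarith)) (Real.exp_pos _).le (by positivity)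
      _ = 2 ^ (-(x / 2)) := by
          rw [← Real.rpow_add two_pos]
          ring_nf
  have hJn : (#J : ℝ) / n ≤ 4 * 2 ^ (-(x / 2)) := by
    have e : (n : ℝ) = k * 2 ^ x := by rw [hpow]; field_simp
    rw [div_le_iff₀ hn0, e]
    calc (#J : ℝ) ≤ 4 * k * 2 ^ (x / 2) := hJ.trans (by gcongr)
      _ = 4 * k * (2 ^ (-(x / 2)) * 2 ^ x) := by
          rw [← Real.rpow_add two_pos]
          ring_nf
      _ = _ := by ring
  have hS' := card_supported_div_le hSk.1 hk (by omega) J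
  have h5 : (2 : ℝ) ^ (-(x / 2)) ≤ 4 * τ := by
    refine (two_rpow_neg_le_div (by linarith)).trans ?_
    rw [div_le_iff₀ (by linarith)]
    linarith
  linarith

/-- The bound for a single slice, with the regimes `k ≥ log n` and `k < log n` unified by a
parameter `z` bounding the depth, the weight and `log n`. -/
theorem one_sub_rpow_le_of_canSample {n k D : ℕ} {η z : ℝ} (hk : k ≤ n) (hk1 : 1 ≤ k)
    (hD : 0 < D) (hl : 16 ≤ Real.logb 2 n) (hlz : Real.logb 2 n ≤ z) (hkz : (k : ℝ) ≤ z)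
    (hDz : (D : ℝ) ≤ z) (hDlog : D * Real.logb 2 z ≤ Real.logb 2 n / 68)
    (h : CanSample (uniformSlice n k hk) D η) : 1 - (n : ℝ) ^ (-(1 / 4 * (k : ℝ))) ≤ η := by
  obtain ⟨m, f, hf, rfl⟩ := h
  set l := Real.logb 2 n with hl'
  have hk' : (1 : ℝ) ≤ k := by exact_mod_cast hk1
  have hD1 : (1 : ℝ) ≤ D := by exact_mod_cast hD
  have hn0 : (0 : ℝ) < n := lt_of_lt_of_le (by linarith) (by exact_mod_cast hk : (k : ℝ) ≤ n)
  have hpow : (n : ℝ) = 2 ^ l := (Real.rpow_logb two_pos (by norm_num) hn0).symm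
  have hz0 : 0 < z := by linarith
  have hlogz : Real.logb 2 z ≤ l / 68 := by
    have : 0 ≤ Real.logb 2 z := Real.logb_nonneg one_lt_two (by linarith)
    nlinarith
  have hkpow : (k : ℝ) ≤ 2 ^ (l / 68) :=
    hkz.trans ((Real.logb_le_iff_le_rpow one_lt_two hz0).mp hlogz)
  have hlk : l ≤ l * k := by nlinarith
  obtain ⟨J, hJ, hdist⟩ := exists_one_sub_le_statDist hD hk1 hf (H := l * k) (by linarith) {k}
    ⟨k, rfl, hk⟩ (fun w hw => le_of_eq hw)
  have hQ : (4 * (1728 * (D : ℝ) ^ 2 * (l * k))) ^ D ≤ (2 : ℝ) ^ (l / 4) := by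
    refine (base_pow_le_two_rpow (by linarith) hDz (by nlinarith) ?_ hDlog).trans (le_of_eq ?_)
    · rw [sq]
      exact mul_le_mul hlz hkz (by linarith) hz0.le
    · ring_nf
  have hM : ((D : ℝ) + 1) * (1728 * D ^ 2 * (l * k)) ^ D * Real.exp (-(l * k)) ≤
      2 ^ (-(l * k / 2)) := by
    calc _ ≤ (2 : ℝ) ^ (l / 4) * 2 ^ (-(l * k)) :=
          mul_le_mul ((succ_mul_pow_le (by nlinarith [sq_nonneg (D : ℝ)])).trans hQ)
            (exp_neg_le_two_rpow_neg (by linarith)) (Real.exp_pos _).le (by positivity)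
      _ = 2 ^ (l / 4 - l * k) := by
          rw [← Real.rpow_add two_pos]
          ring_nf
      _ ≤ 2 ^ (-(l * k / 2)) := Real.rpow_le_rpow_of_exponent_le one_le_two (by linarith)
  have hJn : (#J : ℝ) / n ≤ 2 ^ (-(l / 2)) := by
    rw [div_le_iff₀ hn0]
    have h4 : (4 : ℝ) ≤ 2 ^ (l / 8) := by
      calc (4 : ℝ) = 2 ^ (2 : ℝ) := by rw [Real.rpow_two]; norm_num
        _ ≤ _ := Real.rpow_le_rpow_of_exponent_le one_le_two (by linarith)
    calc (#J : ℝ) ≤ 4 * k * (4 * (1728 * (D : ℝ) ^ 2 * (l * k))) ^ D := hJ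
      _ ≤ 2 ^ (l / 8) * 2 ^ (l / 68) * 2 ^ (l / 4) := by
          refine mul_le_mul (mul_le_mul h4 hkpow (by linarith) (by positivity)) hQ ?_
            (by positivity)
          have : 0 ≤ l * k := by linarith
          positivity
      _ = 2 ^ (l / 8 + l / 68 + l / 4) := by
          rw [← Real.rpow_add two_pos, ← Real.rpow_add two_pos]
      _ ≤ 2 ^ (-(l / 2) + l) := Real.rpow_le_rpow_of_exponent_le one_le_two (by linarith)
      _ = 2 ^ (-(l / 2)) * n := by rw [Real.rpow_add two_pos, ← hpow]
  have hS' := (card_slice_supported_div_le hk J).trans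
    (pow_le_pow_left₀ (div_nonneg (Nat.cast_nonneg _) hn0.le) hJn k)
  have e1 : ((2 : ℝ) ^ (-(l / 2))) ^ k = 2 ^ (-(l * k / 2)) := by
    rw [← Real.rpow_natCast, ← Real.rpow_mul two_pos.le]
    ring_nf
  have e2 : (n : ℝ) ^ (-(1 / 4 * (k : ℝ))) = 2 ^ (-(l * k / 4)) := by
    rw [hpow, ← Real.rpow_mul two_pos.le]
    ring_nf
  have e3 : 2 * (2 : ℝ) ^ (-(l * k / 2)) ≤ 2 ^ (-(l * k / 4)) := by
    calc 2 * (2 : ℝ) ^ (-(l * k / 2)) = 2 ^ (1 + -(l * k / 2)) := by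
          rw [Real.rpow_add two_pos, Real.rpow_one]
      _ ≤ _ := Real.rpow_le_rpow_of_exponent_le one_le_two (by linarith)
  rw [e1] at hS'
  rw [e2, uniformSlice]
  linarith

theorem CanSample.mono {n d d' : ℕ} {η : ℝ} {P : PMF (Fin n → Bool)} (h : CanSample P d η)
    (hd : d ≤ d') : CanSample P d' η := by
  obtain ⟨m, f, hf, he⟩ := h
  exact ⟨m, f, fun j => (hf j).imp fun T hT => ⟨hT.1.trans hd, hT.2⟩, he⟩

theorem exists_threshold {ε : ℝ} (hε : 0 < ε) : ∃ n₀ : ℕ, ∀ n : ℕ, n₀ ≤ n →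
    16 ≤ Real.logb 2 n ∧ 68 ≤ Real.logb 2 n ^ ε ∧
      Real.logb 2 (Real.logb 2 n) ≤ Real.logb 2 n / 68 := by
  have ht : Filter.Tendsto (fun n : ℕ => Real.logb 2 n) Filter.atTop Filter.atTop :=
    (Real.tendsto_logb_atTop one_lt_two).comp tendsto_natCast_atTop_atTop
  have h3 : ∀ᶠ x : ℝ in Filter.atTop, Real.logb 2 x ≤ x / 68 := by
    have hc : 0 < Real.log 2 / 68 := by
      have := Real.log_pos one_lt_two
      positivity
    filter_upwards [Real.isLittleO_log_id_atTop.bound hc, Filter.eventually_ge_atTop 1]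
      with x hx hx1
    rw [Real.norm_of_nonneg (Real.log_nonneg hx1), id, Real.norm_of_nonneg (by linarith)] at hx
    rw [Real.logb, div_le_iff₀ (Real.log_pos one_lt_two)]
    linarith
  have hall := ht.eventually ((Filter.eventually_ge_atTop (16 : ℝ)).and
    (((tendsto_rpow_atTop hε).eventually_ge_atTop 68).and h3))
  exact Filter.eventually_atTop.mp hall

end SliceSampling

open SliceSampling

theorem theorem1 :
    -- Part (1): slices.
    (∀ ε : ℝ, 0 < ε → ∃ τ : ℝ, 0 < τ ∧ ∃ n₀ : ℕ,
      ∀ (n k d : ℕ) (η : ℝ) (hk : k ≤ n), n₀ ≤ n → 1 ≤ k → 4 * k ≤ n →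
        (d : ℝ) ≤ τ * Real.logb 2 (n / k) / Real.logb 2 (Real.logb 2 (n / k)) →
        CanSample (uniformSlice n k hk) d η →
        1 - ε ≤ η) ∧
    -- Part (2): slices of subpolynomial weight.
    (∃ τ : ℝ, 0 < τ ∧ ∃ c : ℝ, 0 < c ∧ ∀ ε : ℝ, 0 < ε → ε < 1 → ∃ n₀ : ℕ,
      ∀ (n k d : ℕ) (η : ℝ) (hk : k ≤ n), n₀ ≤ n →
        ((Real.logb 2 n ≤ k ∧ (k : ℝ) ≤ (2 : ℝ) ^ (Real.logb 2 n ^ (1 - ε)) ∧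
            (d : ℝ) ≤ τ * Real.logb 2 n ^ ε) ∨
          (1 ≤ k ∧ (k : ℝ) < Real.logb 2 n ∧
            (d : ℝ) ≤ τ * Real.logb 2 n ^ ε / Real.logb 2 (Real.logb 2 n))) →
        CanSample (uniformSlice n k hk) d η →
        1 - (n : ℝ) ^ (-(c * k)) ≤ η) ∧
    -- The bound of part (1) for unions of slices.
    (∀ ε : ℝ, 0 < ε → ∃ τ : ℝ, 0 < τ ∧ ∃ n₀ : ℕ,
      ∀ (n k d : ℕ) (η : ℝ) (S : Set ℕ) (hS : ∃ w ∈ S, w ≤ n), S ⊆ Set.Iic n →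
        IsGreatest S k ∨ IsLeast S (n - k) →
        n₀ ≤ n → 1 ≤ k → 4 * k ≤ n →
        (d : ℝ) ≤ τ * Real.logb 2 (n / k) / Real.logb 2 (Real.logb 2 (n / k)) →
        CanSample (uniformUnion n S hS) d η →
        1 - ε ≤ η) := by
  refine ⟨fun ε hε => ⟨min (1 / 34) (ε / 40), by positivity, ⌈2 / ε⌉₊, ?_⟩,
    ⟨1 / 68, by norm_num, 1 / 4, by norm_num, fun ε hε hε1 => ?_⟩,
    fun ε hε => ⟨min (1 / 34) (ε / 40), by positivity, ⌈2 / ε⌉₊, ?_⟩⟩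
  · intro n k d η hk hn hk1 hkn hd h
    exact one_sub_le_of_canSample_of_isGreatest hε (isGreatest_singleton (a := k)) hn hk1 hkn hd h
  · obtain ⟨n₀, hn₀⟩ := exists_threshold hε
    refine ⟨n₀, fun n k d η hk hn hcase h => ?_⟩
    obtain ⟨hl, hlε, hll⟩ := hn₀ n hn
    set l := Real.logb 2 n with hl'
    have hl0 : 0 < l := by linarith
    have hle : l ^ ε ≤ l := by
      calc l ^ ε ≤ l ^ (1 : ℝ) := Real.rpow_le_rpow_of_exponent_le (by linarith) hε1.le
        _ = l := Real.rpow_one l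
    have hmul : l ^ ε * l ^ (1 - ε) = l := by
      rw [← Real.rpow_add hl0, add_sub_cancel, Real.rpow_one]
    have hpos : 0 < l ^ (1 - ε) := Real.rpow_pos_of_pos hl0 _
    -- A sampler of depth `0` is regarded as one of depth `1`.
    have h' := h.mono (le_max_left d 1)
    have hD : ((max d 1 : ℕ) : ℝ) = max (d : ℝ) 1 := by push_cast; rfl
    rcases hcase with ⟨hlk, hkl, hd⟩ | ⟨hk1, hkl, hd⟩
    · have hk0 : (0 : ℝ) < k := by linarith
      have hlogk : Real.logb 2 k ≤ l ^ (1 - ε) :=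
        (Real.logb_le_iff_le_rpow one_lt_two hk0).mpr hkl
      have hlogk0 : 0 ≤ Real.logb 2 (k : ℝ) := Real.logb_nonneg one_lt_two (by linarith)
      refine one_sub_rpow_le_of_canSample (z := k) hk (by exact_mod_cast hk0)
        (by simp) hl hlk le_rfl ?_ ?_ h'
      · rw [hD]
        exact max_le (by linarith) (by linarith)
      · rw [hD]
        rcases le_total (d : ℝ) 1 with h1 | h1
        · rw [max_eq_right h1]
          nlinarith
        · rw [max_eq_left h1]
          calc (d : ℝ) * Real.logb 2 k ≤ (1 / 68 * l ^ ε) * l ^ (1 - ε) :=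
                mul_le_mul hd hlogk hlogk0 (by positivity)
            _ = l / 68 := by rw [mul_assoc, hmul]; ring
    · have hlog1 : 1 ≤ Real.logb 2 l := by
        rw [Real.le_logb_iff_rpow_le one_lt_two hl0, Real.rpow_one]
        linarith
      have hd' : (d : ℝ) * Real.logb 2 l ≤ 1 / 68 * l ^ ε := by
        rwa [le_div_iff₀ (by linarith)] at hd
      have hd0 : (0 : ℝ) ≤ d := Nat.cast_nonneg d
      refine one_sub_rpow_le_of_canSample (z := l) hk hk1
        (by simp) hl le_rfl hkl.le ?_ ?_ h'
      · rw [hD]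
        exact max_le (by nlinarith) (by linarith)
      · rw [hD]
        rcases le_total (d : ℝ) 1 with h1 | h1
        · rw [max_eq_right h1]
          linarith
        · rw [max_eq_left h1]
          linarith
  · intro n k d η S hS hSn hSk hn hk hkn hd h
    rcases hSk with hg | hg
    · exact one_sub_le_of_canSample_of_isGreatest hε hg hn hk hkn hd h
    · have hmem : n - k ∈ S := hg.1
      have hkn' : k ≤ n := by omega
      have hS' : ∃ w ∈ {w | w ≤ n ∧ n - w ∈ S}, w ≤ n := ⟨k, ⟨hkn', hmem⟩, hkn'⟩
      refine one_sub_le_of_canSample_of_isGreatest hε (hS := hS') ⟨⟨hkn', hmem⟩, fun w hw => ?_⟩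
        hn hk hkn hd (h.compl hS')
      have := hg.2 hw.2
      have := hw.1
      omega
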